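/- **Setting.** Let $d,T\ge 1$ be integers, $\delta\in(0,1)$, $\epsilon,\eta,C_0,L_0,L_1>0$, $B,C\ge 0$. Let $f:\mathbb R^d\to\mathbb R$ be differentiable and $(L_0,L_1)$-smooth, i.e. $\|\nabla f(y)-\nabla f(x)\|\le (L_0+L_1\|\nabla f(x)\|)\|x-y\|$ whenever $\|x-y\|\le 1/L_1$, and let $f^*\in\mathbb R$ satisfy $f\ge f^*$ on $\mathbb R^d$. Let $z_1,\dots,z_T$ be independent samples with a common law $P$, and let $g(x,z)\in\mathbb R^d$ be a (jointly measurable) gradient oracle such that for every $x\in\mathbb R^d$ one has $\mathbb E_{z\sim P}[g(x,z)]=\nabla f(x)$ and, for $P$-almost every $z$, $\|g(x,z)-\nabla f(x)\|^2\le B\|\nabla f(x)\|^2+C$. AdaGrad (without momentum) starts from a given $x_1\in\mathbb R^d$ and $v_0=0$ and iterates, for $s=1,\dots,T$ and with coordinate-wise operations, $$g_s=g(x_s,z_s),\qquad v_s=v_{s-1}+g_s^2,\qquad x_{s+1}=x_s-\eta\,\frac{g_s}{\sqrt{v_s}+\epsilon}.$$ Put $\Delta_1=f(x_1)-f^*$,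 $G=\|\nabla f(x_1)\|$ and $$\tilde{\mathcal J}=1+\frac1{\epsilon^2}\left[2(B+1)\left(G+C_0\sqrt d\,T\right)^2T+2CT\right],$$ $$\Lambda_y=\Delta_1+3C_0\log\frac T\delta+\left(C_0d+\tfrac32C_0^2d\right)\log\tilde{\mathcal J},\qquad \Lambda_x=(2L_0+1)\Lambda_y+8L_1\Lambda_y^2+C_0^2d\log\tilde{\mathcal J},$$ $$\mathcal H=\sqrt{2(B+1)\left(4L_1\Lambda_x+\sqrt{4L_0\Lambda_x}\right)^2+2C},\qquad \mathcal L=2L_0+2L_1\left(4L_1\Lambda_x+\sqrt{4L_0\Lambda_x}\right).$$ **Convergence bound.** If $\eta\le\min\left\{C_0,\ \frac{C_0}{\mathcal H},\ \frac{C_0}{\mathcal L},\ \frac1{L_1\sqrt d}\right\}$, then with probability at least $1-\delta$, $$\frac1T\sum_{s=1}^T\|\nabla f(x_s)\|^2\le\frac{4\Lambda_y}{\eta}\left(\frac{2\Lambda_y(B+1)/\eta+\mathcal H+\epsilon}{T}+\sqrt{\frac{2C}{T}}\right).$$ **Order of the constants** (here $\Lambda_y$, $\Lambda_x$ are regarded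 as functions of the parameters, with $\Delta_1,G\ge 0$ arbitrary). (a) There is a universal constant $c>0$ such that always $$\Lambda_y\le c\left(\Delta_1+(C_0^2d+C_0d)\left[\log\left(\frac T\delta+\frac T{\epsilon^2}\right)+\log\left(1+(B+1)(G^2+C_0^2d)+C\right)\right]\right).$$ (b) There are constants $k,K>0$ depending only on $d,B,C,C_0,G$ such that for all $T\ge1$, $\delta\in(0,1)$, $\epsilon>0$, $\Delta_1\ge0$, $$k\left(\Delta_1+C_0^2d\log\left(\frac T\delta+\frac T{\epsilon^2}\right)\right)\le\Lambda_y\le K\left(\Delta_1+C_0^2d\log\left(\frac T\delta+\frac T{\epsilon^2}\right)\right).$$ (c) There are constants $k',K'>0$ depending only on $L_0,L_1,C_0$ such that always $k'\Lambda_y^2\le\Lambda_x\le K'(\Lambda_y+\Lambda_y^2)$, and $\Lambda_x\le K'\Lambda_y^2$ whenever $T\ge2$. -/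

import Mathlib

open MeasureTheory ProbabilityTheory

noncomputable section

namespace AdaGrad

/-- The state of the algorithm: current point, momentum vector, accumulated squared gradients. -/
structure State (d : ℕ) where
  x : EuclideanSpace ℝ (Fin d)
  m : EuclideanSpace ℝ (Fin d)
  v : EuclideanSpace ℝ (Fin d)

/-- One iteration of (coordinate-wise) AdaGrad with heavy-ball momentum on the sample `z`:
`g_s = g(x_s, z_s)`, `v_s = v_{s-1} + g_s²`, `m_s = β m_{s-1} - η g_s / (√v_s + ε)`,
`x_{s+1} = x_s + m_s`, all operations on vectors being coordinate-wise. -/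
def step {d : ℕ} {Z : Type*} (g : EuclideanSpace ℝ (Fin d) → Z → EuclideanSpace ℝ (Fin d))
    (β η ε : ℝ) (z : Z) (S : State d) : State d :=
  let gs : EuclideanSpace ℝ (Fin d) := g S.x z
  let v' : EuclideanSpace ℝ (Fin d) := WithLp.toLp 2 fun i => S.v i + gs i ^ 2
  let m' : EuclideanSpace ℝ (Fin d) :=
    WithLp.toLp 2 fun i => β * S.m i - η * gs i / (Real.sqrt (v' i) + ε)
  { x := S.x + m', m := m', v := v' }

/-- The state `(x_{s+1}, m_s, v_s)` after `s` iterations, on the samples `z 1, …, z s`,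
from `(x₁, m₀, v₀) = (x₁, 0, 0)`. -/
def state {d : ℕ} {Z : Type*} (g : EuclideanSpace ℝ (Fin d) → Z → EuclideanSpace ℝ (Fin d))
    (β η ε : ℝ) (x₁ : EuclideanSpace ℝ (Fin d)) (z : ℕ → Z) : ℕ → State d
  | 0 => { x := x₁, m := 0, v := 0 }
  | s + 1 => step g β η ε (z (s + 1)) (state g β η ε x₁ z s)

/-- The iterate `x_s`, for `s ≥ 1`; it depends on the samples `z 1, …, z (s - 1)` only. -/
def iterate {d : ℕ} {Z : Type*} (g : EuclideanSpace ℝ (Fin d) → Z → EuclideanSpace ℝ (Fin d))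
    (β η ε : ℝ) (x₁ : EuclideanSpace ℝ (Fin d)) (z : ℕ → Z) (s : ℕ) :
    EuclideanSpace ℝ (Fin d) :=
  (state g β η ε x₁ z (s - 1)).x

/-- `(L₀, L₁)`-smoothness of a differentiable function. -/
def GeneralizedSmooth {d : ℕ} (f : EuclideanSpace ℝ (Fin d) → ℝ) (L₀ L₁ : ℝ) : Prop :=
  Differentiable ℝ f ∧
    ∀ x y : EuclideanSpace ℝ (Fin d), ‖x - y‖ ≤ 1 / L₁ →
      ‖gradient f y - gradient f x‖ ≤ (L₀ + L₁ * ‖gradient f x‖) * ‖x - y‖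

/-- (A1): `fstar` is a lower bound of `f`. -/
def BoundedBelowBy {d : ℕ} (f : EuclideanSpace ℝ (Fin d) → ℝ) (fstar : ℝ) : Prop :=
  ∀ x, fstar ≤ f x

/-- (A2): `g(x, z)`, with `z` of law `P`, is an unbiased estimator of `∇f(x)` for every `x`. -/
def UnbiasedOracle {d : ℕ} {Z : Type*} [MeasurableSpace Z]
    (f : EuclideanSpace ℝ (Fin d) → ℝ)
    (g : EuclideanSpace ℝ (Fin d) → Z → EuclideanSpace ℝ (Fin d)) (P : Measure Z) : Prop :=
  ∀ x, Integrable (g x) P ∧ ∫ z, g x z ∂P = gradient f x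

/-- (A3): relaxed almost surely affine variance noise with constants `A, B, C`. -/
def RelaxedAffineNoise {d : ℕ} {Z : Type*} [MeasurableSpace Z]
    (f : EuclideanSpace ℝ (Fin d) → ℝ) (fstar : ℝ)
    (g : EuclideanSpace ℝ (Fin d) → Z → EuclideanSpace ℝ (Fin d)) (P : Measure Z)
    (A B C : ℝ) : Prop :=
  ∀ x, ∀ᵐ z ∂P,
    ‖g x z - gradient f x‖ ^ 2 ≤ A * (f x - fstar) + B * ‖gradient f x‖ ^ 2 + C

/-- The polynomial inside the logarithms of `Λ_y` and `Λ_x`, for `β = 0` and `A = 0`;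
`G` stands for `‖∇f(x₁)‖`. -/
def polyJ (d T : ℕ) (B C C₀ ε G : ℝ) : ℝ :=
  1 + 1 / ε ^ 2 *
    (2 * (B + 1) * (G + C₀ * Real.sqrt d * T) ^ 2 * T + 2 * C * T)

/-- `Λ_y` for `β = 0` and `A = 0`; `Δ₁` stands for `f(x₁) - f*` and `G` for `‖∇f(x₁)‖`. -/
def LambdaY (d T : ℕ) (B C C₀ ε δ Δ₁ G : ℝ) : ℝ :=
  Δ₁ + 3 * C₀ * Real.log (T / δ) + C₀ * d * Real.log (polyJ d T B C C₀ ε G)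
    + C₀ ^ 2 * d / 2 * Real.log (polyJ d T B C C₀ ε G)
    + (C₀ ^ 2 * d / 2 + C₀ ^ 2 * d / 2) * Real.log (polyJ d T B C C₀ ε G)

/-- `Λ_x` for `β = 0` and `A = 0`. -/
def LambdaX (d T : ℕ) (L₀ L₁ B C C₀ ε δ Δ₁ G : ℝ) : ℝ :=
  (2 * L₀ + 1) * LambdaY d T B C C₀ ε δ Δ₁ G
    + 8 * L₁ * LambdaY d T B C C₀ ε δ Δ₁ G ^ 2
    + C₀ ^ 2 * d * Real.log (polyJ d T B C C₀ ε G)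

/-- The constant `𝓗`, as a function of `Λ_x`. -/
def calH (L₀ L₁ A B C Λx : ℝ) : ℝ :=
  Real.sqrt (2 * A * Λx + 2 * (B + 1) * (4 * L₁ * Λx + Real.sqrt (4 * L₀ * Λx)) ^ 2 + 2 * C)

/-- The constant `𝓛`, as a function of `Λ_x`. -/
def calL (L₀ L₁ Λx : ℝ) : ℝ :=
  2 * L₀ + 2 * L₁ * (4 * L₁ * Λx + Real.sqrt (4 * L₀ * Λx))

end AdaGrad

end

/-! The convergence bound separates probability from a pathwise argument. The denominator `√v_s + ε`
contains the current stochastic gradient, so the AdaGrad step is not unbiased. Replacing the squared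
coordinate of that gradient by its largest possible value gives a denominator known before the
sample is drawn (`proxy`). The replacement costs a quarter of the weighted squared gradient plus a
multiple of the squared step length (`neg_mul_div_le_decoupled`), and squared step lengths sum to a
logarithm (`sum_stepEnergy_le`).

What remains is a martingale difference whose square is at most `noiseBound * weightedSq`, a random
but predictable quantity. Hoeffding's lemma makes an exponential compensated by it a supermartingale
(`lintegral_exp_logMartingale_le`). Markov's inequality and a union bound then control the noise at
all times with probability at least `1 - δ`, with no a priori bound on the gradients.

On that event an induction on time closes the loop (`energy_le`). As long as past values satisfy `f
- f* ≤ Λy`, the self-bounding property bounds the gradients, the conditions on `η` make every error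
term affordable, and the descent inequality gives the same bound at the next time. It also bounds
the sum of weighted squared gradients. Since the weights are controlled by the root of the
unweighted sum, a quadratic inequality yields the rate (`sum_sq_le`).

The orders of the constants follow from Bernoulli's inequality, which turns factors inside a
logarithm into factors outside it. -/

noncomputable section

namespace AdaGrad

/-! ### Consequences of generalized smoothness. -/

section Smoothness

variable {d : ℕ} {f : EuclideanSpace ℝ (Fin d) → ℝ} {L₀ L₁ : ℝ}

/-- Along the segment, `f` minus its quadratic upper model has nonpositive derivative. Smoothness is
needed only between `x` and points of the segment, all within distance `1 / L₁`. -/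
theorem GeneralizedSmooth.descent (hf : GeneralizedSmooth f L₀ L₁)
    (x u : EuclideanSpace ℝ (Fin d)) (hu : ‖u‖ ≤ 1 / L₁) :
    f (x + u) ≤ f x + inner ℝ (gradient f x) u
      + (L₀ + L₁ * ‖gradient f x‖) / 2 * ‖u‖ ^ 2 := by
  set K := L₀ + L₁ * ‖gradient f x‖ with hK
  set φ : ℝ → ℝ := fun t => f (x + t • u) - t * inner ℝ (gradient f x) u
    - t ^ 2 * (K / 2 * ‖u‖ ^ 2) with hφ
  have hderiv : ∀ t : ℝ, HasDerivAt φ (inner ℝ (gradient f (x + t • u)) u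
      - inner ℝ (gradient f x) u - 2 * t * (K / 2 * ‖u‖ ^ 2)) t := by
    intro t
    have h1 : HasDerivAt (fun t : ℝ => x + t • u) u t := by
      simpa using ((hasDerivAt_id t).smul_const u).const_add x
    have h2 : HasDerivAt (fun t : ℝ => f (x + t • u)) (inner ℝ (gradient f (x + t • u)) u) t := by
      have := (hf.1 (x + t • u)).hasFDerivAt.comp_hasDerivAt t h1
      rwa [← inner_gradient_left] at this
    have h3 := (hasDerivAt_id t).mul_const (inner ℝ (gradient f x) u)
    have h4 := (hasDerivAt_pow 2 t).mul_const (K / 2 * ‖u‖ ^ 2)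
    convert! (h2.sub h3).sub h4 using 1
    simp
  have hanti : AntitoneOn φ (Set.Icc 0 1) := by
    refine antitoneOn_of_deriv_nonpos (convex_Icc 0 1)
      (fun t _ => (hderiv t).continuousAt.continuousWithinAt)
      (fun t _ => (hderiv t).differentiableAt.differentiableWithinAt) ?_
    intro t ht
    rw [interior_Icc] at ht
    rw [(hderiv t).deriv, ← inner_sub_left]
    have hn : ‖x - (x + t • u)‖ = t * ‖u‖ := by
      simp [norm_smul, abs_of_pos ht.1]
    have hg := hf.2 x (x + t • u) (by
      rw [hn]
      exact (mul_le_of_le_one_left (norm_nonneg u) ht.2.le).trans hu)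
    rw [hn] at hg
    have := (real_inner_le_norm (gradient f (x + t • u) - gradient f x) u).trans
      (mul_le_mul_of_nonneg_right hg (norm_nonneg u))
    nlinarith
  have h01 := hanti (Set.left_mem_Icc.2 zero_le_one) (Set.right_mem_Icc.2 zero_le_one) zero_le_one
  simp only [hφ, one_smul, zero_smul, add_zero] at h01
  linarith

theorem GeneralizedSmooth.continuous_gradient (hf : GeneralizedSmooth f L₀ L₁) (hL₁ : 0 < L₁) :
    Continuous (gradient f) := by
  rw [continuous_iff_continuousAt]
  intro x
  rw [ContinuousAt, tendsto_iff_norm_sub_tendsto_zero]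
  have h1 : Filter.Tendsto (fun y => (L₀ + L₁ * ‖gradient f x‖) * ‖x - y‖) (nhds x) (nhds 0) := by
    have : Continuous fun y => (L₀ + L₁ * ‖gradient f x‖) * ‖x - y‖ := by fun_prop
    simpa using this.tendsto x
  refine squeeze_zero' (Filter.Eventually.of_forall fun _ => norm_nonneg _) ?_ h1
  filter_upwards [Metric.closedBall_mem_nhds x (show (0 : ℝ) < 1 / L₁ by positivity)] with y hy
  refine hf.2 x y ?_
  rwa [mem_closedBall_iff_norm'] at hy

/-- Self-bounding property of the gradient. -/
theorem GeneralizedSmooth.norm_gradient_le (hf : GeneralizedSmooth f L₀ L₁) (hL₀ : 0 < L₀)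
    (hL₁ : 0 < L₁) {fstar Δ : ℝ} (hb : BoundedBelowBy f fstar)
    (x : EuclideanSpace ℝ (Fin d)) (hΔ : f x - fstar ≤ Δ) :
    ‖gradient f x‖ ≤ 4 * L₁ * Δ + Real.sqrt (4 * L₀ * Δ) := by
  set N := ‖gradient f x‖ with hN
  have hN0 : 0 ≤ N := norm_nonneg _
  have hK : 0 < L₀ + L₁ * N := by positivity
  have hΔ0 : 0 ≤ Δ := (sub_nonneg.2 (hb x)).trans hΔ
  have hu : ‖-(1 / (L₀ + L₁ * N)) • gradient f x‖ = N / (L₀ + L₁ * N) := by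
    rw [norm_smul, norm_neg, Real.norm_of_nonneg (by positivity)]
    ring
  -- A gradient step of size `1 / (L₀ + L₁ N)` has length below `1 / L₁` whatever `N` is, so the
  -- descent inequality always applies to it. Since `f` cannot fall below `fstar`, this gives `N² ≤
  -- 2 Δ (L₀ + L₁ N)`.
  have hd := hf.descent x (-(1 / (L₀ + L₁ * N)) • gradient f x) (by
    rw [hu, div_le_div_iff₀ hK hL₁]
    nlinarith)
  rw [hu, inner_smul_right, real_inner_self_eq_norm_sq, ← hN] at hd
  have hlow := hb (x + -(1 / (L₀ + L₁ * N)) • gradient f x)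
  have hkey : N ^ 2 / (2 * (L₀ + L₁ * N)) ≤ Δ := by
    have : -(1 / (L₀ + L₁ * N)) * N ^ 2 + (L₀ + L₁ * N) / 2 * (N / (L₀ + L₁ * N)) ^ 2
        = -(N ^ 2 / (2 * (L₀ + L₁ * N))) := by
      field_simp
      ring
    linarith
  rw [div_le_iff₀ (by positivity)] at hkey
  by_contra! hlt
  have hs := Real.sqrt_nonneg (4 * L₀ * Δ)
  have hs2 := Real.sq_sqrt (show 0 ≤ 4 * L₀ * Δ by positivity)
  set r := Real.sqrt (4 * L₀ * Δ)
  have hLΔ : 0 ≤ L₁ * Δ := by positivity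
  nlinarith [mul_nonneg hLΔ hN0, mul_nonneg hLΔ hs]

end Smoothness

/-! ### Orders of `Λ_y` and `Λ_x`. -/

section Orders

variable {d T : ℕ} {B C C₀ ε δ Δ₁ G : ℝ}

theorem one_le_polyJ (hB : 0 ≤ B) (hC : 0 ≤ C) :
    1 ≤ polyJ d T B C C₀ ε G := by
  unfold polyJ
  have : 0 ≤ 1 / ε ^ 2 * (2 * (B + 1) * (G + C₀ * Real.sqrt d * T) ^ 2 * T + 2 * C * T) := by
    positivity
  linarith

theorem log_polyJ_nonneg (hB : 0 ≤ B) (hC : 0 ≤ C) :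
    0 ≤ Real.log (polyJ d T B C C₀ ε G) :=
  Real.log_nonneg (one_le_polyJ hB hC)

theorem LambdaY_eq : LambdaY d T B C C₀ ε δ Δ₁ G = Δ₁ + 3 * C₀ * Real.log (T / δ)
    + (C₀ * d + 3 / 2 * (C₀ ^ 2 * d)) * Real.log (polyJ d T B C C₀ ε G) := by
  unfold LambdaY
  ring

theorem one_lt_div (hT : 1 ≤ T) (hδ : 0 < δ) (hδ1 : δ < 1) : 1 < (T : ℝ) / δ := by
  have : (1 : ℝ) ≤ T := by exact_mod_cast hT
  rw [lt_div_iff₀ hδ]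
  linarith

theorem polyJ_le (hT : 1 ≤ T) (hB : 0 ≤ B) (hC : 0 ≤ C) :
    polyJ d T B C C₀ ε G ≤
      1 + 4 * ((B + 1) * (G ^ 2 + C₀ ^ 2 * d) + C) * ((T : ℝ) ^ 3 / ε ^ 2) := by
  have hT' : (1 : ℝ) ≤ T := by exact_mod_cast hT
  have hsq : (G + C₀ * Real.sqrt d * T) ^ 2 ≤ 2 * (G ^ 2 + C₀ ^ 2 * d) * T ^ 2 := by
    have hd : Real.sqrt d ^ 2 = d := Real.sq_sqrt (Nat.cast_nonneg d)
    have h1 : (G + C₀ * Real.sqrt d * T) ^ 2 ≤ 2 * (G ^ 2 + (C₀ * Real.sqrt d * T) ^ 2) := by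
      nlinarith [sq_nonneg (G - C₀ * Real.sqrt d * T)]
    have h2 : (C₀ * Real.sqrt d * T) ^ 2 = C₀ ^ 2 * d * T ^ 2 := by
      rw [mul_pow, mul_pow, hd]
    have h3 : G ^ 2 ≤ G ^ 2 * (T : ℝ) ^ 2 :=
      le_mul_of_one_le_right (sq_nonneg G) (one_le_pow₀ hT')
    rw [h2] at h1
    linarith
  have hCT : 2 * C ≤ 4 * C * (T : ℝ) ^ 2 := by
    have : C ≤ C * (T : ℝ) ^ 2 := le_mul_of_one_le_right hC (one_le_pow₀ hT')
    linarith
  unfold polyJ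
  have h4 : 2 * (B + 1) * (G + C₀ * Real.sqrt d * T) ^ 2 * T + 2 * C * T ≤
      4 * ((B + 1) * (G ^ 2 + C₀ ^ 2 * d) + C) * T ^ 3 := by
    have h5 := mul_le_mul_of_nonneg_left hsq (show 0 ≤ 2 * (B + 1) by linarith)
    have h6 := mul_le_mul_of_nonneg_right (add_le_add h5 hCT) (show (0 : ℝ) ≤ T by linarith)
    linarith
  have h7 := mul_le_mul_of_nonneg_left h4 (show 0 ≤ 1 / ε ^ 2 by positivity)
  calc _ ≤ 1 + 1 / ε ^ 2 * (4 * ((B + 1) * (G ^ 2 + C₀ ^ 2 * d) + C) * T ^ 3) := by linarith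
    _ = _ := by ring

/-- As `δ < 1`, the argument of the right-hand logarithm is at least `T (1 + 1/ε²)`, whose cube
dominates `1 + T³/ε²`. -/
theorem log_one_add_cube_le (hT : 1 ≤ T) (hε : 0 < ε) (hδ : 0 < δ) (hδ1 : δ < 1) :
    Real.log (1 + (T : ℝ) ^ 3 / ε ^ 2) ≤ 3 * Real.log (T / δ + T / ε ^ 2) := by
  have hT' : (1 : ℝ) ≤ T := by exact_mod_cast hT
  have hpow : 3 * Real.log (T / δ + T / ε ^ 2) = Real.log ((T / δ + T / ε ^ 2) ^ 3) := by
    simp [Real.log_pow]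
  rw [hpow]
  refine Real.log_le_log (by positivity) ?_
  have hy : 0 ≤ 1 / ε ^ 2 := by positivity
  have h1 : (T : ℝ) * (1 + 1 / ε ^ 2) ≤ T / δ + T / ε ^ 2 := by
    have : (T : ℝ) ≤ T / δ := le_div_self (by linarith) hδ hδ1.le
    have : (T : ℝ) * (1 + 1 / ε ^ 2) = T + T / ε ^ 2 := by ring
    linarith
  have h2 : (1 : ℝ) + 1 / ε ^ 2 ≤ (1 + 1 / ε ^ 2) ^ 3 :=
    le_self_pow₀ (by linarith) (by norm_num)
  have h3 : (1 : ℝ) ≤ (T : ℝ) ^ 3 := one_le_pow₀ hT'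
  calc 1 + (T : ℝ) ^ 3 / ε ^ 2 ≤ (T : ℝ) ^ 3 + (T : ℝ) ^ 3 / ε ^ 2 := by linarith
    _ = (T : ℝ) ^ 3 * (1 + 1 / ε ^ 2) := by ring
    _ ≤ (T : ℝ) ^ 3 * (1 + 1 / ε ^ 2) ^ 3 := by gcongr
    _ = (T * (1 + 1 / ε ^ 2)) ^ 3 := by ring
    _ ≤ _ := by gcongr

theorem log_div_le (hT : 1 ≤ T) (hδ : 0 < δ) (hδ1 : δ < 1) :
    Real.log (T / δ) ≤ Real.log (T / δ + T / ε ^ 2) := by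
  have := one_lt_div hT hδ hδ1
  refine Real.log_le_log (by linarith) ?_
  have : 0 ≤ (T : ℝ) / ε ^ 2 := by positivity
  linarith

theorem LambdaY_le_universal (hd : 1 ≤ d) (hT : 1 ≤ T) (hB : 0 ≤ B) (hC : 0 ≤ C) (hC₀ : 0 < C₀)
    (hε : 0 < ε) (hδ : 0 < δ) (hδ1 : δ < 1) (hΔ : 0 ≤ Δ₁) :
    LambdaY d T B C C₀ ε δ Δ₁ G ≤
      8 * (Δ₁ + (C₀ ^ 2 * d + C₀ * d) * (Real.log (T / δ + T / ε ^ 2)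
        + Real.log (1 + (B + 1) * (G ^ 2 + C₀ ^ 2 * d) + C))) := by
  have hd' : (1 : ℝ) ≤ d := by exact_mod_cast hd
  have hT' : (1 : ℝ) ≤ T := by exact_mod_cast hT
  rw [LambdaY_eq]
  have hl := log_div_le (ε := ε) hT hδ hδ1
  have hl0 : 0 ≤ Real.log (T / δ) := Real.log_nonneg (one_lt_div hT hδ hδ1).le
  have hcube := log_one_add_cube_le hT hε hδ hδ1
  have hJ0 : 0 ≤ Real.log (polyJ d T B C C₀ ε G) := log_polyJ_nonneg hB hC
  set m := (B + 1) * (G ^ 2 + C₀ ^ 2 * d) + C with hm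
  have hm0 : 0 ≤ m := by positivity
  have hM : 1 + (B + 1) * (G ^ 2 + C₀ ^ 2 * d) + C = 1 + m := by ring
  rw [hM]
  have hJ : Real.log (polyJ d T B C C₀ ε G) ≤
      3 * Real.log (T / δ + T / ε ^ 2) + 4 * Real.log (1 + m) := by
    have hy : 0 ≤ (T : ℝ) ^ 3 / ε ^ 2 := by positivity
    -- The exponent 4 absorbs the factor 4 of `polyJ_le`, since `1 + 4m ≤ (1 + m)^4`; this keeps the
    -- constant universal.
    have h1 : polyJ d T B C C₀ ε G ≤ (1 + (T : ℝ) ^ 3 / ε ^ 2) * (1 + m) ^ 4 := by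
      have hb := one_add_mul_le_pow (show (-2 : ℝ) ≤ m by linarith) 4
      calc _ ≤ 1 + 4 * m * ((T : ℝ) ^ 3 / ε ^ 2) := polyJ_le hT hB hC
        _ ≤ (1 + (T : ℝ) ^ 3 / ε ^ 2) * (1 + 4 * m) := by nlinarith
        _ ≤ _ := by
          gcongr
          simpa using hb
    have h2 := Real.log_le_log (zero_lt_one.trans_le (one_le_polyJ hB hC)) h1
    rw [Real.log_mul (by positivity) (by positivity), Real.log_pow] at h2
    push_cast at h2
    linarith
  have hM0 : 0 ≤ Real.log (1 + m) := Real.log_nonneg (by linarith)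
  set ℓ := Real.log (T / δ + T / ε ^ 2)
  set ℓ' := Real.log (1 + m)
  set D := C₀ ^ 2 * (d : ℝ) + C₀ * d with hD
  have hD0 : 0 ≤ D := by positivity
  have hC₀D : C₀ ≤ D := by
    have : C₀ ≤ C₀ * d := le_mul_of_one_le_right hC₀.le hd'
    have : 0 ≤ C₀ ^ 2 * (d : ℝ) := by positivity
    linarith
  have e1 : 3 * C₀ * Real.log (T / δ) ≤ 3 * (D * ℓ) := by
    have := mul_le_mul hC₀D hl hl0 hD0
    linarith
  -- Together with `e1` this gives `3 + 9/2` copies of `D ℓ` and 6 of `D ℓ'`, all within the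
  -- constant 8.
  have e2 : (C₀ * d + 3 / 2 * (C₀ ^ 2 * d)) * Real.log (polyJ d T B C C₀ ε G) ≤
      3 / 2 * D * (3 * ℓ + 4 * ℓ') := by
    refine mul_le_mul ?_ hJ hJ0 (by positivity)
    have : 0 ≤ C₀ * (d : ℝ) := by positivity
    linarith
  have e3 : 0 ≤ D * ℓ := mul_nonneg hD0 (by linarith)
  have e4 : 0 ≤ D * ℓ' := mul_nonneg hD0 hM0
  linarith

theorem exists_LambdaY_bounds (hd : 1 ≤ d) (hB : 0 ≤ B) (hC : 0 ≤ C) (hC₀ : 0 < C₀) (hG : 0 ≤ G) :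
    ∃ k K : ℝ, 0 < k ∧ 0 < K ∧
      ∀ (T : ℕ) (ε δ Δ₁ : ℝ), 1 ≤ T → 0 < ε → 0 < δ → δ < 1 → 0 ≤ Δ₁ →
        k * (Δ₁ + C₀ ^ 2 * d * Real.log (T / δ + T / ε ^ 2)) ≤ LambdaY d T B C C₀ ε δ Δ₁ G ∧
        LambdaY d T B C C₀ ε δ Δ₁ G ≤
          K * (Δ₁ + C₀ ^ 2 * d * Real.log (T / δ + T / ε ^ 2)) := by
  have hd' : (1 : ℝ) ≤ d := by exact_mod_cast hd
  set m := (B + 1) * (G ^ 2 + C₀ ^ 2 * d) + C with hm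
  have hm0 : 0 ≤ m := by positivity
  have hD : 0 < C₀ ^ 2 * (d : ℝ) := by positivity
  -- Both integers are Bernoulli exponents: `1 + 4my ≤ (1 + y)^N` for the upper bound, and `1 + y ≤
  -- (1 + 2C₀²d y)^n` for the lower one.
  obtain ⟨N, hN⟩ := exists_nat_ge (4 * m)
  obtain ⟨n, hn⟩ := exists_nat_ge (1 / (2 * (C₀ ^ 2 * d)))
  have hkk : 0 < 1 + C₀ * d + (n : ℝ) := by positivity
  refine ⟨1 / (1 + C₀ * d + n),
    1 + (3 * C₀ + 3 * N * (C₀ * d + 3 / 2 * (C₀ ^ 2 * d))) / (C₀ ^ 2 * d),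
    by positivity, by positivity, ?_⟩
  intro T ε δ Δ₁ hT hε hδ hδ1 hΔ
  have hT' : (1 : ℝ) ≤ T := by exact_mod_cast hT
  have hl := log_div_le (ε := ε) hT hδ hδ1
  have hl0 : 0 ≤ Real.log (T / δ) := Real.log_nonneg (one_lt_div hT hδ hδ1).le
  have hcube := log_one_add_cube_le hT hε hδ hδ1
  have hJ1 : 1 ≤ polyJ d T B C C₀ ε G := one_le_polyJ hB hC
  have hJ0 : 0 ≤ Real.log (polyJ d T B C C₀ ε G) := log_polyJ_nonneg hB hC
  rw [LambdaY_eq]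
  constructor
  · have hJn : Real.log (1 + T / ε ^ 2) ≤ n * Real.log (polyJ d T B C C₀ ε G) := by
      rw [← Real.log_pow]
      refine Real.log_le_log (by positivity) ?_
      have h1 : 1 + 2 * (C₀ ^ 2 * d) * (T / ε ^ 2) ≤ polyJ d T B C C₀ ε G := by
        have hsd : Real.sqrt d ^ 2 = d := Real.sq_sqrt (Nat.cast_nonneg d)
        have h2 : C₀ ^ 2 * d ≤ (G + C₀ * Real.sqrt d * T) ^ 2 := by
          have : C₀ * Real.sqrt d ≤ G + C₀ * Real.sqrt d * T := by
            have : C₀ * Real.sqrt d ≤ C₀ * Real.sqrt d * T :=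
              le_mul_of_one_le_right (by positivity) hT'
            linarith
          calc C₀ ^ 2 * d = (C₀ * Real.sqrt d) ^ 2 := by rw [mul_pow, hsd]
            _ ≤ _ := by gcongr
        have h3 : 2 * (C₀ ^ 2 * d) ≤ 2 * (B + 1) * (G + C₀ * Real.sqrt d * T) ^ 2 + 2 * C := by
          have : 0 ≤ B * (G + C₀ * Real.sqrt d * T) ^ 2 := by positivity
          linarith
        have h4 := mul_le_mul_of_nonneg_right h3 (show 0 ≤ (T : ℝ) / ε ^ 2 by positivity)
        calc _ ≤ 1 + (2 * (B + 1) * (G + C₀ * Real.sqrt d * T) ^ 2 + 2 * C) * (T / ε ^ 2) := by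
              linarith
          _ = _ := by unfold polyJ; ring
      have hy : 0 ≤ 2 * (C₀ ^ 2 * d) * ((T : ℝ) / ε ^ 2) := by positivity
      have hb := one_add_mul_le_pow
        (show (-2 : ℝ) ≤ 2 * (C₀ ^ 2 * d) * ((T : ℝ) / ε ^ 2) by linarith) n
      have hn1 : 1 ≤ n * (2 * (C₀ ^ 2 * (d : ℝ))) := by
        rwa [div_le_iff₀ (by positivity)] at hn
      have hy' : 0 ≤ (T : ℝ) / ε ^ 2 := by positivity
      calc 1 + (T : ℝ) / ε ^ 2 ≤ 1 + n * (2 * (C₀ ^ 2 * d) * (T / ε ^ 2)) := by nlinarith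
        _ ≤ _ := hb
        _ ≤ _ := by gcongr
    -- Since `T/δ > 1`, the sum `T/δ + T/ε²` is at most the product `(T/δ)(1 + T/ε²)`.
    have hsplit : Real.log (T / δ + T / ε ^ 2) ≤
        Real.log (T / δ) + n * Real.log (polyJ d T B C C₀ ε G) := by
      refine le_trans ?_ (add_le_add_right hJn _)
      have hpos : 0 < (T : ℝ) / δ := by positivity
      rw [← Real.log_mul hpos.ne' (by positivity)]
      refine Real.log_le_log (by positivity) ?_
      have h1 := (one_lt_div hT hδ hδ1).le
      have h2 : 0 ≤ (T : ℝ) / ε ^ 2 := by positivity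
      nlinarith
    rw [one_div, inv_mul_le_iff₀ hkk]
    set lJ := Real.log (polyJ d T B C C₀ ε G)
    have h1 := mul_le_mul_of_nonneg_left hsplit hD.le
    have hn0 : (0 : ℝ) ≤ n := Nat.cast_nonneg n
    have hCd : 0 ≤ C₀ * (d : ℝ) := by positivity
    have hDlJ : 0 ≤ C₀ ^ 2 * d * lJ := by positivity
    have hCdlJ : 0 ≤ C₀ * d * lJ := by positivity
    have hCl : 0 ≤ C₀ * Real.log (T / δ) := by positivity
    have hA : C₀ ^ 2 * d * Real.log (T / δ) = C₀ * d * (C₀ * Real.log (T / δ)) := by ring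
    have hB' : C₀ ^ 2 * d * (n * lJ) = n * (C₀ ^ 2 * d * lJ) := by ring
    have e1 : C₀ * d * (C₀ * Real.log (T / δ)) + n * (C₀ ^ 2 * d * lJ) ≤
        (1 + C₀ * d + n) * (C₀ * Real.log (T / δ) + C₀ ^ 2 * d * lJ) := by
      nlinarith [mul_nonneg hCd hDlJ, mul_nonneg hn0 hCl]
    have e2 : Δ₁ ≤ (1 + C₀ * d + n) * Δ₁ := le_mul_of_one_le_left hΔ (by linarith)
    have e3 : (1 + C₀ * d + n) * (Δ₁ + (C₀ * Real.log (T / δ) + C₀ ^ 2 * d * lJ)) ≤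
        (1 + C₀ * d + n) * (Δ₁ + 3 * C₀ * Real.log (T / δ)
          + (C₀ * d + 3 / 2 * (C₀ ^ 2 * d)) * lJ) := by
      refine mul_le_mul_of_nonneg_left ?_ hkk.le
      linarith
    linarith
  · have hJ : Real.log (polyJ d T B C C₀ ε G) ≤ 3 * N * Real.log (T / δ + T / ε ^ 2) := by
      have hy : 0 ≤ (T : ℝ) ^ 3 / ε ^ 2 := by positivity
      have h1 : polyJ d T B C C₀ ε G ≤ (1 + (T : ℝ) ^ 3 / ε ^ 2) ^ N := by
        calc _ ≤ 1 + 4 * m * ((T : ℝ) ^ 3 / ε ^ 2) := polyJ_le hT hB hC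
          _ ≤ 1 + N * ((T : ℝ) ^ 3 / ε ^ 2) := by gcongr
          _ ≤ _ := one_add_mul_le_pow (by linarith) N
      have h2 := Real.log_le_log (by linarith) h1
      rw [Real.log_pow] at h2
      have := mul_le_mul_of_nonneg_left hcube (Nat.cast_nonneg (α := ℝ) N)
      linarith
    set ℓ := Real.log (T / δ + T / ε ^ 2)
    have e1 : (1 + (3 * C₀ + 3 * N * (C₀ * d + 3 / 2 * (C₀ ^ 2 * d))) / (C₀ ^ 2 * d)) *
        (Δ₁ + C₀ ^ 2 * d * ℓ) = Δ₁ + C₀ ^ 2 * d * ℓ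
          + (3 * C₀ + 3 * N * (C₀ * d + 3 / 2 * (C₀ ^ 2 * d))) / (C₀ ^ 2 * d) * Δ₁
          + (3 * C₀ + 3 * N * (C₀ * d + 3 / 2 * (C₀ ^ 2 * d))) * ℓ := by
      field_simp
      ring
    rw [e1]
    have hℓ0 : 0 ≤ ℓ := by linarith
    have e2 : 0 ≤ (3 * C₀ + 3 * N * (C₀ * d + 3 / 2 * (C₀ ^ 2 * d))) / (C₀ ^ 2 * d) * Δ₁ := by
      positivity
    have e3 : 0 ≤ C₀ ^ 2 * d * ℓ := by positivity
    have e4 : 3 * C₀ * Real.log (T / δ) ≤ 3 * C₀ * ℓ := by gcongr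
    have e5 := mul_le_mul_of_nonneg_left hJ
      (show 0 ≤ C₀ * d + 3 / 2 * (C₀ ^ 2 * (d : ℝ)) by positivity)
    linarith

theorem LambdaY_lower (hB : 0 ≤ B) (hC : 0 ≤ C) (hC₀ : 0 < C₀) :
    Δ₁ + 3 * C₀ * Real.log (T / δ) ≤ LambdaY d T B C C₀ ε δ Δ₁ G := by
  have h1 : 0 ≤ (C₀ * d + 3 / 2 * (C₀ ^ 2 * d)) * Real.log (polyJ d T B C C₀ ε G) :=
    mul_nonneg (by positivity) (log_polyJ_nonneg hB hC)
  rw [LambdaY_eq]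
  linarith

theorem LambdaY_pos (hT : 1 ≤ T) (hB : 0 ≤ B) (hC : 0 ≤ C) (hC₀ : 0 < C₀)
    (hδ : 0 < δ) (hδ1 : δ < 1) (hΔ : 0 ≤ Δ₁) : 0 < LambdaY d T B C C₀ ε δ Δ₁ G := by
  have h1 : 0 < 3 * C₀ * Real.log (T / δ) :=
    mul_pos (by positivity) (Real.log_pos (one_lt_div hT hδ hδ1))
  linarith [LambdaY_lower (d := d) (T := T) (ε := ε) (δ := δ) (Δ₁ := Δ₁) (G := G) hB hC hC₀]

theorem LambdaX_lower {L₀ L₁ : ℝ} (hL₀ : 0 < L₀) (hT : 1 ≤ T) (hB : 0 ≤ B) (hC : 0 ≤ C)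
    (hC₀ : 0 < C₀) (hδ : 0 < δ) (hδ1 : δ < 1) (hΔ : 0 ≤ Δ₁) :
    LambdaY d T B C C₀ ε δ Δ₁ G + 8 * L₁ * LambdaY d T B C C₀ ε δ Δ₁ G ^ 2 ≤
      LambdaX d T L₀ L₁ B C C₀ ε δ Δ₁ G := by
  have hY := LambdaY_pos (d := d) (ε := ε) (G := G) hT hB hC hC₀ hδ hδ1 hΔ
  have h1 : 0 ≤ C₀ ^ 2 * d * Real.log (polyJ d T B C C₀ ε G) :=
    mul_nonneg (by positivity) (log_polyJ_nonneg hB hC)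
  have h2 := mul_pos hL₀ hY
  unfold LambdaX
  linarith

theorem LambdaX_upper {L₀ L₁ : ℝ} (hT : 1 ≤ T) (hB : 0 ≤ B) (hC : 0 ≤ C)
    (hC₀ : 0 < C₀) (hδ : 0 < δ) (hδ1 : δ < 1) (hΔ : 0 ≤ Δ₁) :
    LambdaX d T L₀ L₁ B C C₀ ε δ Δ₁ G ≤ (2 * L₀ + 2) * LambdaY d T B C C₀ ε δ Δ₁ G
      + 8 * L₁ * LambdaY d T B C C₀ ε δ Δ₁ G ^ 2 := by
  have h1 : 0 ≤ C₀ ^ 2 * d * Real.log (polyJ d T B C C₀ ε G) :=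
    mul_nonneg (by positivity) (log_polyJ_nonneg hB hC)
  have h2 : 0 ≤ C₀ * d * Real.log (polyJ d T B C C₀ ε G) :=
    mul_nonneg (by positivity) (log_polyJ_nonneg hB hC)
  have h3 : 0 ≤ 3 * C₀ * Real.log (T / δ) :=
    mul_nonneg (by positivity) (Real.log_nonneg (one_lt_div hT hδ hδ1).le)
  have h4 : C₀ ^ 2 * d * Real.log (polyJ d T B C C₀ ε G) ≤ LambdaY d T B C C₀ ε δ Δ₁ G := by
    rw [LambdaY_eq]
    linarith
  unfold LambdaX
  linarith

/-- The linear term of `Λ_x` is absorbed by the square once `Λ_y` stays away from 0. For `T ≥ 2` it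
is at least `3 C₀ log 2`; for `T = 1` it can be arbitrarily small (`Δ₁ = 0`, `δ` near 1, `ε` large).
-/
theorem exists_LambdaX_bounds {L₀ L₁ : ℝ} (hL₀ : 0 < L₀) (hL₁ : 0 < L₁) (hC₀ : 0 < C₀) :
    ∃ k K : ℝ, 0 < k ∧ 0 < K ∧
      ∀ (d T : ℕ) (B C ε δ Δ₁ G : ℝ), 1 ≤ d → 1 ≤ T → 0 ≤ B → 0 ≤ C → 0 < ε →
        0 < δ → δ < 1 → 0 ≤ Δ₁ → 0 ≤ G →
        k * LambdaY d T B C C₀ ε δ Δ₁ G ^ 2 ≤ LambdaX d T L₀ L₁ B C C₀ ε δ Δ₁ G ∧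
        LambdaX d T L₀ L₁ B C C₀ ε δ Δ₁ G ≤
          K * (LambdaY d T B C C₀ ε δ Δ₁ G + LambdaY d T B C C₀ ε δ Δ₁ G ^ 2) ∧
        (2 ≤ T → LambdaX d T L₀ L₁ B C C₀ ε δ Δ₁ G ≤ K * LambdaY d T B C C₀ ε δ Δ₁ G ^ 2) := by
  have hlog2 : 0 < Real.log 2 := Real.log_pos one_lt_two
  set q := 1 / (3 * C₀ * Real.log 2) with hq
  have hq0 : 0 < q := by positivity
  refine ⟨8 * L₁, (2 * L₀ + 2) * (1 + q) + 8 * L₁, by positivity, by positivity, ?_⟩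
  intro d T B C ε δ Δ₁ G _ hT hB hC _ hδ hδ1 hΔ _
  have hY := LambdaY_pos (d := d) (ε := ε) (G := G) hT hB hC hC₀ hδ hδ1 hΔ
  have hlow := LambdaX_lower (d := d) (ε := ε) (G := G) (L₁ := L₁) hL₀ hT hB hC hC₀ hδ hδ1 hΔ
  have hup := LambdaX_upper (d := d) (ε := ε) (G := G) (L₀ := L₀) (L₁ := L₁)
    hT hB hC hC₀ hδ hδ1 hΔ
  have hYl := LambdaY_lower (d := d) (T := T) (ε := ε) (δ := δ) (Δ₁ := Δ₁) (G := G) hB hC hC₀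
  set Y := LambdaY d T B C C₀ ε δ Δ₁ G
  set X := LambdaX d T L₀ L₁ B C C₀ ε δ Δ₁ G
  have hL₀q : 0 ≤ (2 * L₀ + 2) * q := by positivity
  refine ⟨by linarith, ?_, fun h2 => ?_⟩
  · have e1 : 0 ≤ (2 * L₀ + 2) * q * Y := by positivity
    have e2 : 0 ≤ (2 * L₀ + 2) * (1 + q) * Y ^ 2 := by positivity
    have e3 : 0 ≤ 8 * L₁ * Y := by positivity
    linarith
  · have hT2 : (2 : ℝ) ≤ T := by exact_mod_cast h2
    have h3 : Real.log 2 ≤ Real.log (T / δ) := by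
      refine Real.log_le_log two_pos (hT2.trans ?_)
      exact le_div_self (by linarith) hδ hδ1.le
    have h4 : 3 * C₀ * Real.log 2 ≤ Y := by
      have := mul_le_mul_of_nonneg_left h3 (show 0 ≤ 3 * C₀ by positivity)
      linarith
    have h5 : Y ≤ q * Y ^ 2 := by
      rw [hq, one_div, le_inv_mul_iff₀ (by positivity)]
      nlinarith
    have e1 := mul_le_mul_of_nonneg_left h5 (show 0 ≤ 2 * L₀ + 2 by positivity)
    have e2 : 0 ≤ (2 * L₀ + 2) * Y ^ 2 := by positivity
    linarith

end Orders

/-! ### One AdaGrad step: decoupling the gradient from its denominator. -/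

section Decoupling

/-- The largest norm that a stochastic gradient can have where the gradient has norm `N`. -/
def noiseBound (B C N : ℝ) : ℝ := Real.sqrt (2 * (B + 1) * N ^ 2 + 2 * C)

variable {d : ℕ}

/-- The predictable proxy for `√v_s + ε`, for the gradient `p` and `v = v_{s-1}`. -/
def proxy (B C ε : ℝ) (p v : EuclideanSpace ℝ (Fin d)) (i : Fin d) : ℝ :=
  Real.sqrt (v i + noiseBound B C ‖p‖ ^ 2) + ε

/-- The squared norm of the gradient `p`, weighted by the inverses of the proxies. -/
def weightedSq (B C ε : ℝ) (p v : EuclideanSpace ℝ (Fin d)) : ℝ :=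
  ∑ i, p i ^ 2 / proxy B C ε p v i

/-- The scalar product of the gradient with the noise, weighted by the inverses of the proxies. -/
def noiseTerm (B C ε : ℝ) (p v γ : EuclideanSpace ℝ (Fin d)) : ℝ :=
  ∑ i, p i * (γ i - p i) / proxy B C ε p v i

/-- The squared length of an AdaGrad step with `η = 1` along the stochastic gradient `γ`. -/
def stepEnergy (ε : ℝ) (v γ : EuclideanSpace ℝ (Fin d)) : ℝ :=
  ∑ i, γ i ^ 2 / (Real.sqrt (v i + γ i ^ 2) + ε) ^ 2

/-- The AdaGrad step along the stochastic gradient `γ`. -/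
def move (η ε : ℝ) (v γ : EuclideanSpace ℝ (Fin d)) : EuclideanSpace ℝ (Fin d) :=
  WithLp.toLp 2 fun i => -(η * γ i / (Real.sqrt (v i + γ i ^ 2) + ε))

section OneStep

variable {B C ε η : ℝ} {p v γ : EuclideanSpace ℝ (Fin d)}

theorem noiseBound_nonneg (B C N : ℝ) : 0 ≤ noiseBound B C N := Real.sqrt_nonneg _

theorem sq_noiseBound (hB : 0 ≤ B) (hC : 0 ≤ C) (N : ℝ) :
    noiseBound B C N ^ 2 = 2 * (B + 1) * N ^ 2 + 2 * C :=
  Real.sq_sqrt (by positivity)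

theorem noiseBound_mono (hB : 0 ≤ B) {N N' : ℝ} (hN : 0 ≤ N) (h : N ≤ N') :
    noiseBound B C N ≤ noiseBound B C N' := by
  unfold noiseBound
  gcongr

theorem norm_sq_noise_le (hB : 0 ≤ B) (hC : 0 ≤ C)
    (h : ‖γ - p‖ ^ 2 ≤ B * ‖p‖ ^ 2 + C) : ‖γ - p‖ ^ 2 ≤ noiseBound B C ‖p‖ ^ 2 := by
  rw [sq_noiseBound hB hC]
  have : 0 ≤ B * ‖p‖ ^ 2 := by positivity
  nlinarith [sq_nonneg ‖p‖]

theorem norm_sq_le_noiseBound (hB : 0 ≤ B) (hC : 0 ≤ C)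
    (h : ‖γ - p‖ ^ 2 ≤ B * ‖p‖ ^ 2 + C) : ‖γ‖ ^ 2 ≤ noiseBound B C ‖p‖ ^ 2 := by
  rw [sq_noiseBound hB hC]
  have h1 : ‖γ‖ ≤ ‖γ - p‖ + ‖p‖ := by simpa using norm_add_le (γ - p) p
  nlinarith [sq_nonneg (‖γ - p‖ - ‖p‖), norm_nonneg γ, norm_nonneg p, norm_nonneg (γ - p)]

theorem coord_sq_le_norm_sq (γ : EuclideanSpace ℝ (Fin d)) (i : Fin d) : γ i ^ 2 ≤ ‖γ‖ ^ 2 := by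
  rw [EuclideanSpace.real_norm_sq_eq]
  exact Finset.single_le_sum (f := fun j => γ j ^ 2) (fun j _ => sq_nonneg _) (Finset.mem_univ i)

theorem noiseBound_le_proxy (hε : 0 < ε) (hv : ∀ i, 0 ≤ v i) (i : Fin d) :
    noiseBound B C ‖p‖ ≤ proxy B C ε p v i := by
  have : noiseBound B C ‖p‖ ≤ Real.sqrt (v i + noiseBound B C ‖p‖ ^ 2) :=
    Real.le_sqrt_of_sq_le (by linarith [hv i])
  unfold proxy
  linarith

theorem proxy_pos (hε : 0 < ε) (i : Fin d) : 0 < proxy B C ε p v i := by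
  unfold proxy
  positivity

theorem weightedSq_nonneg (hε : 0 < ε) : 0 ≤ weightedSq B C ε p v :=
  Finset.sum_nonneg fun i _ => div_nonneg (sq_nonneg _) (proxy_pos hε i).le

theorem stepEnergy_nonneg : 0 ≤ stepEnergy ε v γ :=
  Finset.sum_nonneg fun _ _ => div_nonneg (sq_nonneg _) (sq_nonneg _)

/-- Decoupling of the stochastic gradient from the step size, in one coordinate. -/
theorem neg_mul_div_le_decoupled {p γ v G ε : ℝ} (hv : 0 ≤ v) (hG : 0 ≤ G) (hγ : γ ^ 2 ≤ G ^ 2)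
    (hε : 0 < ε) :
    -(p * γ / (Real.sqrt (v + γ ^ 2) + ε)) ≤
      -(3 / 4) * (p ^ 2 / (Real.sqrt (v + G ^ 2) + ε))
        - p * (γ - p) / (Real.sqrt (v + G ^ 2) + ε)
        + G * (γ ^ 2 / (Real.sqrt (v + γ ^ 2) + ε) ^ 2) := by
  have hGa : G ≤ Real.sqrt (v + G ^ 2) := Real.le_sqrt_of_sq_le (by linarith)
  have hba : Real.sqrt (v + γ ^ 2) ≤ Real.sqrt (v + G ^ 2) := by gcongr
  have hab : Real.sqrt (v + G ^ 2) ≤ Real.sqrt (v + γ ^ 2) + G := by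
    calc Real.sqrt (v + G ^ 2) ≤ Real.sqrt v + G := by
          refine Real.sqrt_le_iff.2 ⟨by positivity, ?_⟩
          nlinarith [Real.sq_sqrt hv, mul_nonneg (Real.sqrt_nonneg v) hG]
      _ ≤ Real.sqrt (v + γ ^ 2) + G := by
          gcongr
          linarith [sq_nonneg γ]
  have hr := Real.sqrt_nonneg (v + γ ^ 2)
  set a := Real.sqrt (v + G ^ 2) + ε with ha
  set b := Real.sqrt (v + γ ^ 2) + ε with hb
  have ha0 : 0 < a := by linarith
  have hb0 : 0 < b := by linarith
  set w := γ / b with hw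
  -- Here `a` is the predictable denominator and `b` the true one. As `a - b` lies between 0 and
  -- both `G` and `a`, its square is at most `G a`. Young's inequality then takes only `p²/(4a)`
  -- from `p²/a`, which leaves the factor `3/4`.
  have h1 : (a - b) ^ 2 * w ^ 2 ≤ G * a * w ^ 2 := by
    refine mul_le_mul_of_nonneg_right ?_ (sq_nonneg w)
    nlinarith
  have h2 : -(p * w) * (a - b) ≤ p ^ 2 / 4 + G * a * w ^ 2 := by
    nlinarith [sq_nonneg (p / 2 + w * (a - b))]
  have h3 : (-(p * w) * (a - b)) / a ≤ (p ^ 2 / 4 + G * a * w ^ 2) / a := by gcongr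
  have e1 : (-(p * w) * (a - b)) / a = -(p * w) + p * γ / a := by
    rw [hw]
    field_simp
    ring
  have e2 : (p ^ 2 / 4 + G * a * w ^ 2) / a = 1 / 4 * (p ^ 2 / a) + G * w ^ 2 := by
    field_simp
  have e3 : p * (γ - p) / a = p * γ / a - p ^ 2 / a := by ring
  have e4 : γ ^ 2 / b ^ 2 = w ^ 2 := by rw [hw, div_pow]
  have e5 : p * γ / b = p * w := by rw [hw]; ring
  rw [e3, e4, e5]
  linarith

theorem norm_sq_move : ‖move η ε v γ‖ ^ 2 = η ^ 2 * stepEnergy ε v γ := by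
  rw [EuclideanSpace.real_norm_sq_eq, stepEnergy, Finset.mul_sum]
  refine Finset.sum_congr rfl fun i _ => ?_
  simp only [move]
  rw [neg_sq, div_pow, mul_pow, mul_div_assoc]

theorem stepEnergy_le (hε : 0 < ε) (hv : ∀ i, 0 ≤ v i) : stepEnergy ε v γ ≤ d := by
  have : ∀ i ∈ Finset.univ, γ i ^ 2 / (Real.sqrt (v i + γ i ^ 2) + ε) ^ 2 ≤ 1 := by
    intro i _
    have h0 : 0 ≤ v i + γ i ^ 2 := add_nonneg (hv i) (sq_nonneg _)
    have h1 := Real.sq_sqrt h0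
    have h2 := Real.sqrt_nonneg (v i + γ i ^ 2)
    rw [div_le_one (by positivity)]
    nlinarith [hv i]
  simpa [stepEnergy] using Finset.sum_le_sum this

theorem norm_move_le (hη : 0 ≤ η) (hε : 0 < ε) (hv : ∀ i, 0 ≤ v i) :
    ‖move η ε v γ‖ ≤ η * Real.sqrt d := by
  refine le_of_sq_le_sq ?_ (by positivity)
  rw [norm_sq_move, mul_pow, Real.sq_sqrt (Nat.cast_nonneg d)]
  exact mul_le_mul_of_nonneg_left (stepEnergy_le hε hv) (sq_nonneg η)

theorem inner_move_le (hη : 0 ≤ η) (hε : 0 < ε) (hB : 0 ≤ B) (hC : 0 ≤ C)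
    (hv : ∀ i, 0 ≤ v i) (h : ‖γ - p‖ ^ 2 ≤ B * ‖p‖ ^ 2 + C) :
    inner ℝ p (move η ε v γ) ≤ η * (-(3 / 4) * weightedSq B C ε p v - noiseTerm B C ε p v γ
      + noiseBound B C ‖p‖ * stepEnergy ε v γ) := by
  have hsum := Finset.sum_le_sum fun i (_ : i ∈ Finset.univ) =>
    neg_mul_div_le_decoupled (p := p i) (hv i) (noiseBound_nonneg B C ‖p‖)
      ((coord_sq_le_norm_sq γ i).trans (norm_sq_le_noiseBound hB hC h)) hε
  rw [Finset.sum_add_distrib, Finset.sum_sub_distrib, ← Finset.mul_sum, ← Finset.mul_sum] at hsum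
  have hin : inner ℝ p (move η ε v γ)
      = η * ∑ i, -(p i * γ i / (Real.sqrt (v i + γ i ^ 2) + ε)) := by
    rw [PiLp.inner_apply, Finset.mul_sum]
    refine Finset.sum_congr rfl fun i _ => ?_
    simp only [move, RCLike.inner_apply, conj_trivial]
    ring
  rw [hin]
  exact mul_le_mul_of_nonneg_left hsum hη

theorem GeneralizedSmooth.move_descent {f : EuclideanSpace ℝ (Fin d) → ℝ} {L₀ L₁ : ℝ}
    (hf : GeneralizedSmooth f L₀ L₁) (hη : 0 ≤ η) (hηd : η * Real.sqrt d ≤ 1 / L₁) (hε : 0 < ε)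
    (hB : 0 ≤ B) (hC : 0 ≤ C) (hv : ∀ i, 0 ≤ v i) {x : EuclideanSpace ℝ (Fin d)}
    (h : ‖γ - gradient f x‖ ^ 2 ≤ B * ‖gradient f x‖ ^ 2 + C) :
    f (x + move η ε v γ) ≤ f x - 3 / 4 * (η * weightedSq B C ε (gradient f x) v)
      - η * noiseTerm B C ε (gradient f x) v γ
      + (η * noiseBound B C ‖gradient f x‖ + (L₀ + L₁ * ‖gradient f x‖) / 2 * η ^ 2)
        * stepEnergy ε v γ := by
  have h1 := hf.descent x (move η ε v γ) ((norm_move_le hη hε hv).trans hηd)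
  have h2 := inner_move_le hη hε hB hC hv h
  rw [norm_sq_move] at h1
  linarith

/-- Cauchy–Schwarz with the weights `1 / proxy`; the noise factor is at most `noiseBound` because
the proxies are at least that large. Keeping `weightedSq` in the bound lets the descent absorb the
variance later. -/
theorem sq_noiseTerm_le (hε : 0 < ε) (hB : 0 ≤ B) (hC : 0 ≤ C)
    (hv : ∀ i, 0 ≤ v i) (h : ‖γ - p‖ ^ 2 ≤ B * ‖p‖ ^ 2 + C) :
    noiseTerm B C ε p v γ ^ 2 ≤ noiseBound B C ‖p‖ * weightedSq B C ε p v := by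
  have hcs : noiseTerm B C ε p v γ ^ 2 ≤
      weightedSq B C ε p v * ∑ i, (γ i - p i) ^ 2 / proxy B C ε p v i := by
    refine Finset.sum_sq_le_sum_mul_sum_of_sq_le_mul _
      (fun i _ => div_nonneg (sq_nonneg _) (proxy_pos hε i).le)
      (fun i _ => div_nonneg (sq_nonneg _) (proxy_pos hε i).le) fun i _ => ?_
    rw [div_pow, mul_pow, div_mul_div_comm, sq (proxy B C ε p v i)]
  have hn := norm_sq_noise_le hB hC h
  have hξ : ∑ i, (γ i - p i) ^ 2 / proxy B C ε p v i ≤ noiseBound B C ‖p‖ := by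
    have hsum : ∑ i, (γ i - p i) ^ 2 = ‖γ - p‖ ^ 2 := by
      rw [EuclideanSpace.real_norm_sq_eq]
      rfl
    rcases (noiseBound_nonneg B C ‖p‖).eq_or_lt with h0 | h0
    -- If `noiseBound` is 0 the noise vanishes; the division by it below would be meaningless.
    · rw [← h0]
      refine Finset.sum_nonpos fun i _ => ?_
      have h1 : (γ i - p i) ^ 2 ≤ 0 := by
        have := coord_sq_le_norm_sq (γ - p) i
        rw [← h0] at hn
        simp only [PiLp.sub_apply] at this
        linarith
      exact div_nonpos_of_nonpos_of_nonneg h1 (proxy_pos hε i).le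
    · calc ∑ i, (γ i - p i) ^ 2 / proxy B C ε p v i
          ≤ ∑ i, (γ i - p i) ^ 2 / noiseBound B C ‖p‖ := by
            gcongr with i
            exact noiseBound_le_proxy hε hv i
        _ = ‖γ - p‖ ^ 2 / noiseBound B C ‖p‖ := by rw [← Finset.sum_div, hsum]
        _ ≤ noiseBound B C ‖p‖ := by
            rw [div_le_iff₀ h0]
            linarith
  calc _ ≤ _ := hcs
    _ ≤ weightedSq B C ε p v * noiseBound B C ‖p‖ :=
        mul_le_mul_of_nonneg_left hξ (weightedSq_nonneg hε)
    _ = _ := mul_comm _ _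

end OneStep

/-! ### Logarithmic growth of the total squared step length. -/

section Accumulation

/-- This is `1 - 1/r ≤ log r` for the ratio `r` of successive accumulators shifted by `ε²`, so the
right-hand sides telescope over time. -/
theorem sq_div_le_log {v γ ε : ℝ} (hv : 0 ≤ v) (hε : 0 < ε) :
    γ ^ 2 / (Real.sqrt (v + γ ^ 2) + ε) ^ 2 ≤
      Real.log (v + γ ^ 2 + ε ^ 2) - Real.log (v + ε ^ 2) := by
  have h0 : 0 ≤ v + γ ^ 2 := by positivity
  have hA : 0 < v + ε ^ 2 := by positivity
  have hA' : 0 < v + γ ^ 2 + ε ^ 2 := by positivity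
  have h1 := Real.one_sub_inv_le_log_of_pos (div_pos hA' hA)
  rw [Real.log_div hA'.ne' hA.ne', inv_div] at h1
  refine le_trans ?_ h1
  have h2 : 1 - (v + ε ^ 2) / (v + γ ^ 2 + ε ^ 2) = γ ^ 2 / (v + γ ^ 2 + ε ^ 2) := by
    field_simp
    ring
  rw [h2]
  gcongr
  nlinarith [Real.sq_sqrt h0, Real.sqrt_nonneg (v + γ ^ 2)]

variable {ε : ℝ} {v γ : ℕ → EuclideanSpace ℝ (Fin d)}

theorem accumulated_nonneg (hv0 : v 0 = 0) (hv : ∀ n i, v (n + 1) i = v n i + γ n i ^ 2)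
    (n : ℕ) (i : Fin d) : 0 ≤ v n i := by
  induction n with
  | zero => simp [hv0]
  | succ n ih =>
    rw [hv]
    positivity

theorem accumulated_le (hv0 : v 0 = 0) (hv : ∀ n i, v (n + 1) i = v n i + γ n i ^ 2)
    (n : ℕ) (i : Fin d) : v n i ≤ ∑ k ∈ Finset.range n, ‖γ k‖ ^ 2 := by
  induction n with
  | zero => simp [hv0]
  | succ n ih =>
    rw [hv, Finset.sum_range_succ]
    exact add_le_add ih (coord_sq_le_norm_sq _ i)

theorem sum_stepEnergy_le (hε : 0 < ε) (hv0 : v 0 = 0)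
    (hv : ∀ n i, v (n + 1) i = v n i + γ n i ^ 2) {t : ℕ} {J : ℝ}
    (hJ : ∀ i, 1 + v t i / ε ^ 2 ≤ J) :
    ∑ n ∈ Finset.range t, stepEnergy ε (v n) (γ n) ≤ d * Real.log J := by
  unfold stepEnergy
  rw [Finset.sum_comm]
  have hcoord : ∀ i ∈ Finset.univ, ∑ n ∈ Finset.range t,
      γ n i ^ 2 / (Real.sqrt (v n i + γ n i ^ 2) + ε) ^ 2 ≤ Real.log J := by
    intro i _
    have h1 : ∑ n ∈ Finset.range t, γ n i ^ 2 / (Real.sqrt (v n i + γ n i ^ 2) + ε) ^ 2 ≤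
        ∑ n ∈ Finset.range t, (Real.log (v (n + 1) i + ε ^ 2) - Real.log (v n i + ε ^ 2)) := by
      refine Finset.sum_le_sum fun n _ => ?_
      rw [hv]
      exact sq_div_le_log (accumulated_nonneg hv0 hv n i) hε
    rw [Finset.sum_range_sub (fun n => Real.log (v n i + ε ^ 2))] at h1
    refine h1.trans ?_
    have hvt := accumulated_nonneg hv0 hv t i
    rw [← Real.log_div (by positivity) (by simp [hv0, hε.ne'])]
    refine Real.log_le_log (by simp only [hv0, PiLp.zero_apply]; positivity) (le_trans (le_of_eq ?_) (hJ i))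
    simp only [hv0, PiLp.zero_apply, zero_add]
    field_simp
    ring
  simpa using Finset.sum_le_sum hcoord

end Accumulation

end Decoupling

/-! ### Pathwise analysis of a trajectory. -/

section Trajectory

/-- The inequality `S ≤ K (√(2(B+1)S) + R)` solved for `S`. -/
theorem le_of_le_mul_sqrt_add {S K B R : ℝ} (hS : 0 ≤ S) (hB : 0 ≤ B)
    (h : S ≤ K * (Real.sqrt (2 * (B + 1) * S) + R)) :
    S ≤ 2 * K * (K * (B + 1) + R) := by
  have h1 := Real.sq_sqrt (show 0 ≤ 2 * (B + 1) * S by positivity)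
  set r := Real.sqrt (2 * (B + 1) * S)
  have h2 : K * r ≤ S / 2 + K ^ 2 * (B + 1) := by
    have h3 : (B + 1) * (K * r) ≤ (B + 1) * (S / 2 + K ^ 2 * (B + 1)) := by
      nlinarith [sq_nonneg (r - 2 * ((B + 1) * K))]
    exact le_of_mul_le_mul_left h3 (by linarith)
  linarith

variable {d : ℕ} {f : EuclideanSpace ℝ (Fin d) → ℝ} {fstar L₀ L₁ B C C₀ η ε δ : ℝ}
  {x v γ : ℕ → EuclideanSpace ℝ (Fin d)}

/-- A trajectory of AdaGrad along the stochastic gradients `γ 0, γ 1, …`, on which the affine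
bound on the noise holds during the first `T` steps. -/
structure IsTrajectory (f : EuclideanSpace ℝ (Fin d) → ℝ) (B C η ε : ℝ) (T : ℕ)
    (x v γ : ℕ → EuclideanSpace ℝ (Fin d)) : Prop where
  zero_v : v 0 = 0
  succ_v : ∀ n i, v (n + 1) i = v n i + γ n i ^ 2
  succ_x : ∀ n, x (n + 1) = x n + move η ε (v n) (γ n)
  noise : ∀ n < T, ‖γ n - gradient f (x n)‖ ^ 2 ≤ B * ‖gradient f (x n)‖ ^ 2 + C

namespace IsTrajectory

variable {T : ℕ}

theorem v_nonneg (h : IsTrajectory f B C η ε T x v γ) (n : ℕ) (i : Fin d) : 0 ≤ v n i :=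
  accumulated_nonneg h.zero_v h.succ_v n i

theorem v_le (h : IsTrajectory f B C η ε T x v γ) (hB : 0 ≤ B) (hC : 0 ≤ C) {t : ℕ} (ht : t ≤ T)
    (i : Fin d) :
    v t i ≤ 2 * (B + 1) * ∑ n ∈ Finset.range t, ‖gradient f (x n)‖ ^ 2 + 2 * C * t := by
  refine (accumulated_le h.zero_v h.succ_v t i).trans ?_
  calc ∑ n ∈ Finset.range t, ‖γ n‖ ^ 2
      ≤ ∑ n ∈ Finset.range t, (2 * (B + 1) * ‖gradient f (x n)‖ ^ 2 + 2 * C) := by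
        refine Finset.sum_le_sum fun n hn => ?_
        rw [← sq_noiseBound hB hC]
        exact norm_sq_le_noiseBound hB hC (h.noise n ((Finset.mem_range.1 hn).trans_le ht))
    _ = _ := by
        rw [Finset.sum_add_distrib, ← Finset.mul_sum]
        simp
        ring

/-- Each step has length at most `η √d`, hence changes the gradient by at most `C₀ √d`. This crude
growth avoids a circularity: `Λ_x` already contains the logarithm of `polyJ`, so the gradient bound
derived from `Λ_x` cannot serve to define `polyJ`. -/
theorem norm_gradient_le_linear (h : IsTrajectory f B C η ε T x v γ)
    (hf : GeneralizedSmooth f L₀ L₁) (hL₀ : 0 ≤ L₀) (hL₁ : 0 ≤ L₁)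
    (hη : 0 ≤ η) (hηd : η * Real.sqrt d ≤ 1 / L₁) (hε : 0 < ε)
    {t : ℕ} (hC₀ : ∀ n < t, η * (L₀ + L₁ * ‖gradient f (x n)‖) ≤ C₀) {n : ℕ} (hn : n ≤ t) :
    ‖gradient f (x n)‖ ≤ ‖gradient f (x 0)‖ + C₀ * Real.sqrt d * n := by
  induction n with
  | zero => simp
  | succ n ih =>
    have hm := norm_move_le (γ := γ n) hη hε (h.v_nonneg n)
    have hx : ‖x n - x (n + 1)‖ = ‖move η ε (v n) (γ n)‖ := by
      rw [h.succ_x, sub_add_cancel_left, norm_neg]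
    have h1 := hf.2 (x n) (x (n + 1)) (by rw [hx]; exact hm.trans hηd)
    rw [hx] at h1
    have h2 : ‖gradient f (x (n + 1))‖ ≤
        ‖gradient f (x (n + 1)) - gradient f (x n)‖ + ‖gradient f (x n)‖ := by
      simpa using norm_add_le (gradient f (x (n + 1)) - gradient f (x n)) (gradient f (x n))
    have hd := Real.sqrt_nonneg d
    have h4 : (L₀ + L₁ * ‖gradient f (x n)‖) * ‖move η ε (v n) (γ n)‖ ≤ C₀ * Real.sqrt d := by
      calc _ ≤ (L₀ + L₁ * ‖gradient f (x n)‖) * (η * Real.sqrt d) := by gcongr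
        _ = η * (L₀ + L₁ * ‖gradient f (x n)‖) * Real.sqrt d := by ring
        _ ≤ _ := by
          gcongr
          exact hC₀ n hn
    have h7 := ih (by omega)
    push_cast
    linarith

/-- The logarithmic bound on the total step energy, as long as the gradients grow linearly. -/
theorem sum_stepEnergy_le_polyJ (h : IsTrajectory f B C η ε T x v γ) (hB : 0 ≤ B) (hC : 0 ≤ C)
    (hC₀ : 0 ≤ C₀) (hε : 0 < ε) {t : ℕ} (ht : t ≤ T)
    (hgrad : ∀ n < t, ‖gradient f (x n)‖ ≤ ‖gradient f (x 0)‖ + C₀ * Real.sqrt d * n) :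
    ∑ n ∈ Finset.range t, stepEnergy ε (v n) (γ n) ≤
      d * Real.log (polyJ d T B C C₀ ε ‖gradient f (x 0)‖) := by
  refine sum_stepEnergy_le hε h.zero_v h.succ_v fun i => ?_
  have hsum : ∑ n ∈ Finset.range t, ‖gradient f (x n)‖ ^ 2 ≤
      (‖gradient f (x 0)‖ + C₀ * Real.sqrt d * T) ^ 2 * t := by
    have := Finset.sum_le_card_nsmul (Finset.range t) (fun n => ‖gradient f (x n)‖ ^ 2)
      ((‖gradient f (x 0)‖ + C₀ * Real.sqrt d * T) ^ 2) fun n hn => by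
        have hn' := Finset.mem_range.1 hn
        have hnT : (n : ℝ) ≤ T := by exact_mod_cast (hn'.trans_le ht).le
        have := hgrad n hn'
        gcongr
        exact this.trans (by gcongr)
    simpa [mul_comm] using this
  have htT : (t : ℝ) ≤ T := by exact_mod_cast ht
  have hv := h.v_le hB hC ht i
  unfold polyJ
  rw [div_eq_inv_mul, ← one_div]
  gcongr
  calc v t i ≤ 2 * (B + 1) * ((‖gradient f (x 0)‖ + C₀ * Real.sqrt d * T) ^ 2 * t) + 2 * C * t := by
        refine hv.trans ?_
        gcongr
    _ ≤ 2 * (B + 1) * ((‖gradient f (x 0)‖ + C₀ * Real.sqrt d * T) ^ 2 * T) + 2 * C * T := by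
        gcongr
    _ = _ := by ring

theorem sum_descent (h : IsTrajectory f B C η ε T x v γ) (hf : GeneralizedSmooth f L₀ L₁)
    (hη : 0 ≤ η) (hηd : η * Real.sqrt d ≤ 1 / L₁) (hε : 0 < ε) (hB : 0 ≤ B) (hC : 0 ≤ C)
    {t : ℕ} (ht : t ≤ T) {c : ℝ}
    (hc : ∀ n < t, η * noiseBound B C ‖gradient f (x n)‖
      + (L₀ + L₁ * ‖gradient f (x n)‖) / 2 * η ^ 2 ≤ c) :
    f (x t) ≤ f (x 0)
      - 3 / 4 * (η * ∑ n ∈ Finset.range t, weightedSq B C ε (gradient f (x n)) (v n))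
      - η * ∑ n ∈ Finset.range t, noiseTerm B C ε (gradient f (x n)) (v n) (γ n)
      + c * ∑ n ∈ Finset.range t, stepEnergy ε (v n) (γ n) := by
  induction t with
  | zero => simp
  | succ t ih =>
    have h1 := ih (by omega) fun n hn => hc n (by omega)
    have h2 := hf.move_descent hη hηd hε hB hC (h.v_nonneg t) (h.noise t ht)
    rw [← h.succ_x] at h2
    have h3 := mul_le_mul_of_nonneg_right (hc t (by omega))
      (stepEnergy_nonneg (ε := ε) (v := v t) (γ := γ t))
    simp only [Finset.sum_range_succ]
    linarith

/-- The bound on the function values and on the weighted squared gradients, where the noise is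
controlled in the form given by the concentration inequality. -/
theorem energy_le (h : IsTrajectory f B C η ε T x v γ) (hf : GeneralizedSmooth f L₀ L₁)
    (hb : BoundedBelowBy f fstar) (hL₀ : 0 < L₀)
    (hL₁ : 0 < L₁) (hB : 0 ≤ B) (hC : 0 ≤ C) (hC₀ : 0 < C₀) (hη : 0 < η) (hε : 0 < ε)
    {Λy Λx : ℝ}
    (hΛy : Λy = LambdaY d T B C C₀ ε δ (f (x 0) - fstar) ‖gradient f (x 0)‖)
    (hΛ : Λy ≤ Λx) (hηC₀ : η ≤ C₀) (hηH : η * calH L₀ L₁ 0 B C Λx ≤ C₀)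
    (hηL : η * calL L₀ L₁ Λx ≤ C₀) (hηd : η * Real.sqrt d ≤ 1 / L₁)
    (hmart : ∀ t ≤ T, -(η * ∑ n ∈ Finset.range t,
        noiseTerm B C ε (gradient f (x n)) (v n) (γ n)) ≤
      η ^ 2 / (6 * C₀) * ∑ n ∈ Finset.range t, noiseBound B C ‖gradient f (x n)‖
        * weightedSq B C ε (gradient f (x n)) (v n) + 3 * C₀ * Real.log (T / δ))
    {t : ℕ} (ht : t ≤ T) :
    f (x t) - fstar
      + η / 2 * ∑ n ∈ Finset.range t, weightedSq B C ε (gradient f (x n)) (v n) ≤ Λy := by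
  -- Every estimate at time `t` uses gradients at times `n < t` only, and these are bounded through
  -- the induction hypothesis and `Λy ≤ Λx`.
  induction t using Nat.strong_induction_on with
  | _ t ih =>
  have hW : ∀ n, 0 ≤ weightedSq B C ε (gradient f (x n)) (v n) := fun n => weightedSq_nonneg hε
  have hΔ : ∀ n < t, f (x n) - fstar ≤ Λx := by
    intro n hn
    have h1 := ih n hn (by omega)
    have h2 : 0 ≤ η / 2 * ∑ k ∈ Finset.range n, weightedSq B C ε (gradient f (x k)) (v k) :=
      mul_nonneg (by positivity) (Finset.sum_nonneg fun k _ => hW k)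
    linarith
  have hN : ∀ n < t, ‖gradient f (x n)‖ ≤ 4 * L₁ * Λx + Real.sqrt (4 * L₀ * Λx) :=
    fun n hn => hf.norm_gradient_le hL₀ hL₁ hb _ (hΔ n hn)
  have hH : ∀ n < t, η * noiseBound B C ‖gradient f (x n)‖ ≤ C₀ := by
    intro n hn
    refine le_trans ?_ hηH
    refine mul_le_mul_of_nonneg_left ((noiseBound_mono hB (norm_nonneg _) (hN n hn)).trans ?_) hη.le
    simp [calH, noiseBound]
  have hL : ∀ n < t, η * (L₀ + L₁ * ‖gradient f (x n)‖) ≤ C₀ / 2 := by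
    intro n hn
    have h1 := mul_le_mul_of_nonneg_left (hN n hn) hL₁.le
    have h2 : L₀ + L₁ * ‖gradient f (x n)‖ ≤ calL L₀ L₁ Λx / 2 := by
      unfold calL
      linarith
    have h3 := mul_le_mul_of_nonneg_left h2 hη.le
    linarith
  have hlin : ∀ n < t, ‖gradient f (x n)‖ ≤ ‖gradient f (x 0)‖ + C₀ * Real.sqrt d * n :=
    fun n hn => h.norm_gradient_le_linear hf hL₀.le hL₁.le hη.le hηd hε
      (fun k hk => (hL k hk).trans (by linarith)) hn.le
  have hlog := h.sum_stepEnergy_le_polyJ hB hC hC₀.le hε ht hlin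
  -- The noise part contributes `C₀`; the smoothness part is half of `η (L₀ + L₁ ‖∇f‖) · η ≤ (C₀/2)
  -- · C₀`.
  have hdesc := h.sum_descent hf hη.le hηd hε hB hC ht (c := C₀ + C₀ ^ 2 / 4) fun n hn => by
    refine add_le_add (hH n hn) ?_
    have h1 := mul_le_mul (hL n hn) hηC₀ hη.le (by positivity)
    linarith
  -- The variance costs `1/6` of the weighted sum, and `3/4 - 1/6 ≥ 1/2` is what the claim needs.
  have hquad : η ^ 2 / (6 * C₀) * ∑ n ∈ Finset.range t, noiseBound B C ‖gradient f (x n)‖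
        * weightedSq B C ε (gradient f (x n)) (v n) ≤
      1 / 6 * (η * ∑ n ∈ Finset.range t, weightedSq B C ε (gradient f (x n)) (v n)) := by
    rw [Finset.mul_sum, Finset.mul_sum, Finset.mul_sum]
    refine Finset.sum_le_sum fun n hn => ?_
    have h1 := mul_le_mul_of_nonneg_right (hH n (Finset.mem_range.1 hn))
      (mul_nonneg hη.le (hW n))
    have h2 := mul_le_mul_of_nonneg_left h1 (show 0 ≤ 1 / (6 * C₀) by positivity)
    calc _ = 1 / (6 * C₀) * (η * noiseBound B C ‖gradient f (x n)‖
          * (η * weightedSq B C ε (gradient f (x n)) (v n))) := by ring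
      _ ≤ _ := h2
      _ = _ := by field_simp
  have hm := hmart t ht
  have hWs : 0 ≤ η * ∑ n ∈ Finset.range t, weightedSq B C ε (gradient f (x n)) (v n) :=
    mul_nonneg hη.le (Finset.sum_nonneg fun k _ => hW k)
  have hlogc := mul_le_mul_of_nonneg_left hlog (show 0 ≤ C₀ + C₀ ^ 2 / 4 by positivity)
  have hJ0 : 0 ≤ C₀ ^ 2 * d * Real.log (polyJ d T B C C₀ ε ‖gradient f (x 0)‖) :=
    mul_nonneg (by positivity) (log_polyJ_nonneg hB hC)
  rw [hΛy, LambdaY_eq]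
  linarith

/-- All proxies are below one number `A` that grows like `√S`, so `S` is at most `A` times the
weighted sum. This inequality, quadratic in `√S`, is solved by `le_of_le_mul_sqrt_add`. -/
theorem sum_sq_le (h : IsTrajectory f B C η ε T x v γ) (hT : 0 < T) (hB : 0 ≤ B) (hC : 0 ≤ C) (hη : 0 < η)
    (hε : 0 < ε) {Λ H : ℝ} (hH : ∀ n < T, noiseBound B C ‖gradient f (x n)‖ ≤ H)
    (hE : η / 2 * ∑ n ∈ Finset.range T, weightedSq B C ε (gradient f (x n)) (v n) ≤ Λ) :
    ∑ n ∈ Finset.range T, ‖gradient f (x n)‖ ^ 2 ≤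
      4 * Λ / η * (2 * Λ * (B + 1) / η + H + ε + Real.sqrt (2 * C * T)) := by
  set S := ∑ n ∈ Finset.range T, ‖gradient f (x n)‖ ^ 2 with hS
  have hS0 : 0 ≤ S := Finset.sum_nonneg fun _ _ => sq_nonneg _
  set A := Real.sqrt (2 * (B + 1) * S) + (Real.sqrt (2 * C * T) + H + ε) with hA
  have hproxy : ∀ n < T, ∀ i, proxy B C ε (gradient f (x n)) (v n) i ≤ A := by
    intro n hn i
    have h1 : v n i ≤ 2 * (B + 1) * S + 2 * C * T := by
      refine (h.v_le hB hC hn.le i).trans ?_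
      have hnT : (n : ℝ) ≤ T := by exact_mod_cast hn.le
      have h2 : ∑ k ∈ Finset.range n, ‖gradient f (x k)‖ ^ 2 ≤ S :=
        Finset.sum_le_sum_of_subset_of_nonneg (Finset.range_subset_range.2 hn.le)
          fun _ _ _ => sq_nonneg _
      gcongr
    have h3 : Real.sqrt (v n i + noiseBound B C ‖gradient f (x n)‖ ^ 2) ≤
        Real.sqrt (2 * (B + 1) * S) + Real.sqrt (2 * C * T) + H := by
      have h4 := hH n hn
      have h5 := noiseBound_nonneg B C ‖gradient f (x n)‖
      have h6 := Real.sqrt_nonneg (2 * (B + 1) * S)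
      have h7 := Real.sqrt_nonneg (2 * C * T)
      have h8 := Real.sq_sqrt (show 0 ≤ 2 * (B + 1) * S by positivity)
      have h9 := Real.sq_sqrt (show 0 ≤ 2 * C * T by positivity)
      refine Real.sqrt_le_iff.2 ⟨by linarith, ?_⟩
      nlinarith [mul_nonneg h6 h7, mul_nonneg (add_nonneg h6 h7) (h5.trans h4)]
    unfold proxy
    linarith
  have hSW : S ≤ ∑ n ∈ Finset.range T, weightedSq B C ε (gradient f (x n)) (v n) * A := by
    refine Finset.sum_le_sum fun n hn => ?_
    rw [EuclideanSpace.real_norm_sq_eq, weightedSq, Finset.sum_mul]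
    refine Finset.sum_le_sum fun i _ => ?_
    have hp := proxy_pos (B := B) (C := C) (p := gradient f (x n)) (v := v n) hε i
    rw [div_mul_eq_mul_div, le_div_iff₀ hp]
    exact mul_le_mul_of_nonneg_left (hproxy n (Finset.mem_range.1 hn) i) (sq_nonneg _)
  rw [← Finset.sum_mul] at hSW
  have hW : ∑ n ∈ Finset.range T, weightedSq B C ε (gradient f (x n)) (v n) ≤ 2 * Λ / η := by
    rw [le_div_iff₀ hη]
    linarith
  have hA0 : 0 ≤ A := by
    have := (noiseBound_nonneg B C _).trans (hH 0 hT)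
    positivity
  refine (le_of_le_mul_sqrt_add hS0 hB (hSW.trans (mul_le_mul_of_nonneg_right hW hA0))).trans
    (le_of_eq ?_)
  ring

end IsTrajectory

end Trajectory

/-- The logarithm of one factor of the exponential supermartingale. -/
def logFactor {d : ℕ} (B C ε c : ℝ) (p v γ : EuclideanSpace ℝ (Fin d)) : ℝ :=
  -(c * noiseTerm B C ε p v γ) - c ^ 2 / 2 * (noiseBound B C ‖p‖ * weightedSq B C ε p v)

/-! ### Exponential moment of one noise term. -/

section Hoeffding

variable {d : ℕ} {Z : Type*} [MeasurableSpace Z] {P : Measure Z} {B C ε : ℝ}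
  {p v : EuclideanSpace ℝ (Fin d)} {γ : Z → EuclideanSpace ℝ (Fin d)}

theorem integral_noiseTerm [IsProbabilityMeasure P] (hγ : Integrable γ P)
    (hmean : ∫ z, γ z ∂P = p) : ∫ z, noiseTerm B C ε p v (γ z) ∂P = 0 := by
  have hcoord : ∀ i, Integrable (fun z => γ z i) P := fun i =>
    (EuclideanSpace.proj (𝕜 := ℝ) i).integrable_comp hγ
  have hint : ∀ i, ∫ z, γ z i ∂P = p i := fun i => by
    rw [← hmean]
    exact (EuclideanSpace.proj (𝕜 := ℝ) i).integral_comp_comm hγ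
  unfold noiseTerm
  have hterm : ∀ i, Integrable (fun z => p i * (γ z i - p i) / proxy B C ε p v i) P := fun i =>
    (((hcoord i).sub (integrable_const _)).const_mul _).div_const _
  rw [integral_finsetSum _ fun i _ => hterm i]
  refine Finset.sum_eq_zero fun i _ => ?_
  rw [integral_div, integral_const_mul, integral_sub (hcoord i) (integrable_const _), hint]
  simp

/-- For a fixed past the proxies are constants, so the noise term is centred and lies in `[-√σ2,
√σ2]`. Hoeffding's lemma bounds its exponential moment by exactly the compensator subtracted in
`logFactor`. -/
theorem lintegral_exp_logFactor_le [IsProbabilityMeasure P] (hB : 0 ≤ B) (hC : 0 ≤ C) (hε : 0 < ε)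
    (hv : ∀ i, 0 ≤ v i) (hγ : Integrable γ P) (hmean : ∫ z, γ z ∂P = p)
    (hnoise : ∀ᵐ z ∂P, ‖γ z - p‖ ^ 2 ≤ B * ‖p‖ ^ 2 + C) (c : ℝ) :
    ∫⁻ z, ENNReal.ofReal (Real.exp (logFactor B C ε c p v (γ z))) ∂P ≤ 1 := by
  set σ2 := noiseBound B C ‖p‖ * weightedSq B C ε p v with hσ2
  have hσ2n : 0 ≤ σ2 := mul_nonneg (noiseBound_nonneg _ _ _) (weightedSq_nonneg hε)
  set X : Z → ℝ := fun z => noiseTerm B C ε p v (γ z) with hX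
  have hXm : AEMeasurable X P := by
    have hcoord : ∀ i, AEMeasurable (fun z => γ z i) P := fun i =>
      ((EuclideanSpace.proj (𝕜 := ℝ) i).integrable_comp hγ).aemeasurable
    simp only [hX, noiseTerm]
    exact Finset.aemeasurable_fun_sum _ fun i _ =>
      (((hcoord i).sub_const _).const_mul _).div_const _
  have hXb : ∀ᵐ z ∂P, X z ∈ Set.Icc (-Real.sqrt σ2) (Real.sqrt σ2) := by
    filter_upwards [hnoise] with z hz
    exact abs_le.1 (Real.abs_le_sqrt (sq_noiseTerm_le hε hB hC hv hz))
  have hsub := hasSubgaussianMGF_of_mem_Icc_of_integral_eq_zero hXm hXb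
    (integral_noiseTerm hγ hmean)
  have hmgf := hsub.mgf_le (-c)
  have hint := hsub.integrable_exp_mul (-c)
  have hconst : ((((‖Real.sqrt σ2 - -Real.sqrt σ2‖₊ / 2) ^ 2 : NNReal) : ℝ)) = σ2 := by
    push_cast
    rw [sub_neg_eq_add, Real.norm_of_nonneg (by positivity), ← two_mul,
      mul_div_cancel_left₀ _ two_ne_zero, Real.sq_sqrt hσ2n]
  rw [hconst] at hmgf
  have hfac : ∀ z, Real.exp (logFactor B C ε c p v (γ z)) =
      Real.exp (-c * X z) * Real.exp (-(c ^ 2 / 2 * σ2)) := by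
    intro z
    rw [← Real.exp_add]
    congr 1
    simp only [logFactor, hX, hσ2]
    ring
  simp_rw [hfac]
  rw [← ofReal_integral_eq_lintegral_ofReal (hint.mul_const _)
    (Filter.Eventually.of_forall fun z => by positivity), integral_mul_const]
  refine ENNReal.ofReal_le_one.2 ?_
  calc _ ≤ Real.exp (σ2 * (-c) ^ 2 / 2) * Real.exp (-(c ^ 2 / 2 * σ2)) := by
        gcongr
        exact hmgf
    _ = 1 := by
        rw [← Real.exp_add, ← Real.exp_zero]
        congr 1
        ring

end Hoeffding

/-! ### Integrating out a fresh sample. -/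

section Independence

variable {Ω Z : Type*} [MeasurableSpace Ω] [MeasurableSpace Z] {μ : Measure Ω}
  [IsProbabilityMeasure μ] {P : Measure Z} {T : ℕ} {z : ℕ → Ω → Z}

/-- Integration over a fresh sample, given the past. -/
theorem lintegral_past_next (hz : ∀ s, Measurable (z s))
    (hP : ∀ s ∈ Finset.Icc 1 T, μ.map (z s) = P)
    (hind : iIndepFun (fun s : Finset.Icc 1 T => z s) μ) {t : ℕ} (ht : t < T)
    {K : (ℕ → Z) → Z → ENNReal} (hK : Measurable (Function.uncurry K))
    (hloc : ∀ u u', (∀ n ∈ Finset.Icc 1 t, u n = u' n) → K u = K u') :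
    ∫⁻ ω, K (fun n => z n ω) (z (t + 1) ω) ∂μ = ∫⁻ ω, ∫⁻ w, K (fun n => z n ω) w ∂P ∂μ := by
  obtain ⟨ω₀⟩ : Nonempty Ω := nonempty_of_isProbabilityMeasure μ
  have htT : t + 1 ∈ Finset.Icc 1 T := Finset.mem_Icc.2 ⟨by omega, ht⟩
  -- Freezing the coordinates outside `1, …, t` leaves `K` unchanged and makes the past a function
  -- of `z 1, …, z t`, hence independent of `z (t + 1)`. Tonelli then replaces conditional
  -- expectations.
  set U : Ω → ℕ → Z := fun ω n => if n ∈ Finset.Icc 1 t then z n ω else z 0 ω₀ with hU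
  have hUm : Measurable U := by
    refine measurable_pi_iff.2 fun n => ?_
    by_cases hn : n ∈ Finset.Icc 1 t
    · simp only [hU, hn, if_true]
      exact hz n
    · simp only [hU, hn, if_false]
      exact measurable_const
  have hUK : ∀ ω, K (fun n => z n ω) = K (U ω) := fun ω =>
    hloc _ _ fun n hn => by simp only [hU, if_pos hn]
  have hindU : IndepFun U (z (t + 1)) μ := by
    let S₁ : Finset (Finset.Icc 1 T) := Finset.univ.filter fun s => (s : ℕ) ≤ t
    let S₂ : Finset (Finset.Icc 1 T) := {⟨t + 1, htT⟩}
    have hdisj : Disjoint S₁ S₂ := by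
      rw [Finset.disjoint_singleton_right]
      simp [S₁]
    have h1 := hind.indepFun_finset S₁ S₂ hdisj fun s => hz s
    have hmem : ∀ n ∈ Finset.Icc 1 t, n ∈ Finset.Icc 1 T := fun n hn => by
      rw [Finset.mem_Icc] at hn ⊢
      omega
    let φ : (S₁ → Z) → ℕ → Z := fun a n =>
      if hn : n ∈ Finset.Icc 1 t then
        a ⟨⟨n, hmem n hn⟩, Finset.mem_filter.2 ⟨Finset.mem_univ _, (Finset.mem_Icc.1 hn).2⟩⟩
      else z 0 ω₀
    let ψ : (S₂ → Z) → Z := fun a => a ⟨⟨t + 1, htT⟩, Finset.mem_singleton_self _⟩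
    have hφ : Measurable φ := by
      refine measurable_pi_iff.2 fun n => ?_
      by_cases hn : n ∈ Finset.Icc 1 t
      · simp only [φ, hn, dif_pos]
        exact measurable_pi_apply _
      · simp only [φ, hn, dif_neg, not_false_eq_true]
        exact measurable_const
    have hψ : Measurable ψ := measurable_pi_apply _
    have h2 := h1.comp hφ hψ
    convert! h2 using 1
  have hmap := (indepFun_iff_map_prod_eq_prod_map_map hUm.aemeasurable
    (hz (t + 1)).aemeasurable).1 hindU
  have hPp : IsProbabilityMeasure P := by
    rw [← hP _ htT]
    exact Measure.isProbabilityMeasure_map (hz _).aemeasurable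
  simp_rw [hUK]
  calc ∫⁻ ω, K (U ω) (z (t + 1) ω) ∂μ
      = ∫⁻ q, Function.uncurry K q ∂(μ.map fun ω => (U ω, z (t + 1) ω)) := by
        rw [lintegral_map hK (hUm.prodMk (hz _))]
        rfl
    _ = ∫⁻ u, ∫⁻ w, K u w ∂P ∂(μ.map U) := by
        rw [hmap, hP _ htT, lintegral_prod _ hK.aemeasurable]
        rfl
    _ = _ := by
        exact lintegral_map hK.lintegral_prod_right' hUm

end Independence

/-! ### Locality and measurability of the iterates. -/

section Iterates

variable {d : ℕ} {Z : Type*} {g : EuclideanSpace ℝ (Fin d) → Z → EuclideanSpace ℝ (Fin d)}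
  {η ε : ℝ} {x₁ : EuclideanSpace ℝ (Fin d)}

theorem state_congr {β : ℝ} {u u' : ℕ → Z} {t : ℕ} (h : ∀ n ∈ Finset.Icc 1 t, u n = u' n) :
    state g β η ε x₁ u t = state g β η ε x₁ u' t := by
  induction t with
  | zero => rfl
  | succ t ih =>
    have h1 := ih fun n hn => h n (Finset.Icc_subset_Icc_right (Nat.le_succ t) hn)
    simp only [state, h1, h (t + 1) (Finset.mem_Icc.2 ⟨by omega, le_rfl⟩)]

theorem measurable_state [MeasurableSpace Z] {β : ℝ} (hg : Measurable (Function.uncurry g)) (t : ℕ) :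
    Measurable (fun u : ℕ → Z => (state g β η ε x₁ u t).x) ∧
    Measurable (fun u : ℕ → Z => (state g β η ε x₁ u t).m) ∧
    Measurable (fun u : ℕ → Z => (state g β η ε x₁ u t).v) := by
  induction t with
  | zero => exact ⟨measurable_const, measurable_const, measurable_const⟩
  | succ t ih =>
    obtain ⟨hx, hm, hv⟩ := ih
    have hγ : Measurable fun u : ℕ → Z => g (state g β η ε x₁ u t).x (u (t + 1)) :=
      hg.comp (hx.prodMk (measurable_pi_apply _))
    have hv' : Measurable fun u : ℕ → Z => (state g β η ε x₁ u (t + 1)).v := by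
      simp only [state, step]
      refine (WithLp.measurable_toLp 2 _).comp (measurable_pi_iff.2 fun i => ?_)
      fun_prop
    have hm' : Measurable fun u : ℕ → Z => (state g β η ε x₁ u (t + 1)).m := by
      simp only [state, step]
      refine (WithLp.measurable_toLp 2 _).comp (measurable_pi_iff.2 fun i => ?_)
      fun_prop
    exact ⟨hx.add hm', hm', hv'⟩

/-- Index shift: position `t` carries `x_{t+1}`, `v_t` and the gradient sample `g_{t+1}`. With `β =
0` the momentum vector is just the current step. -/
theorem isTrajectory_state {f : EuclideanSpace ℝ (Fin d) → ℝ} {B C : ℝ} {T : ℕ} (u : ℕ → Z)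
    (h : ∀ t < T, ‖g (state g 0 η ε x₁ u t).x (u (t + 1)) - gradient f (state g 0 η ε x₁ u t).x‖ ^ 2
      ≤ B * ‖gradient f (state g 0 η ε x₁ u t).x‖ ^ 2 + C) :
    IsTrajectory f B C η ε T (fun t => (state g 0 η ε x₁ u t).x)
      (fun t => (state g 0 η ε x₁ u t).v)
      (fun t => g (state g 0 η ε x₁ u t).x (u (t + 1))) where
  zero_v := rfl
  succ_v _ _ := rfl
  succ_x t := by
    simp only [state, step, move, zero_mul, zero_sub]
  noise := h

theorem state_v_nonneg {β : ℝ} (u : ℕ → Z) (t : ℕ) (i : Fin d) :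
    0 ≤ (state g β η ε x₁ u t).v i :=
  accumulated_nonneg (v := fun t => (state g β η ε x₁ u t).v)
    (γ := fun t => g (state g β η ε x₁ u t).x (u (t + 1))) rfl (fun _ _ => rfl) t i

end Iterates

theorem measurable_noiseTerm_comp {d : ℕ} {α : Type*} [MeasurableSpace α] {B C ε : ℝ}
    {p v γ : α → EuclideanSpace ℝ (Fin d)} (hp : Measurable p) (hv : Measurable v)
    (hγ : Measurable γ) : Measurable fun a => noiseTerm B C ε (p a) (v a) (γ a) := by
  unfold noiseTerm proxy noiseBound
  fun_prop

theorem measurable_logFactor_comp {d : ℕ} {α : Type*} [MeasurableSpace α] {B C ε c : ℝ}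
    {p v γ : α → EuclideanSpace ℝ (Fin d)} (hp : Measurable p) (hv : Measurable v)
    (hγ : Measurable γ) : Measurable fun a => logFactor B C ε c (p a) (v a) (γ a) := by
  have h1 := measurable_noiseTerm_comp (B := B) (C := C) (ε := ε) hp hv hγ
  unfold logFactor weightedSq proxy noiseBound
  fun_prop

/-! ### The exponential supermartingale. -/

section Martingale

variable {Z : Type*} {d : ℕ} {f : EuclideanSpace ℝ (Fin d) → ℝ}
  {g : EuclideanSpace ℝ (Fin d) → Z → EuclideanSpace ℝ (Fin d)}
  {B C η ε c : ℝ} {x₁ : EuclideanSpace ℝ (Fin d)}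

/-- The logarithm of the exponential supermartingale. -/
def logMartingale (f : EuclideanSpace ℝ (Fin d) → ℝ)
    (g : EuclideanSpace ℝ (Fin d) → Z → EuclideanSpace ℝ (Fin d)) (B C η ε c : ℝ)
    (x₁ : EuclideanSpace ℝ (Fin d)) (t : ℕ) (u : ℕ → Z) : ℝ :=
  ∑ n ∈ Finset.range t, logFactor B C ε c (gradient f (state g 0 η ε x₁ u n).x)
    (state g 0 η ε x₁ u n).v (g (state g 0 η ε x₁ u n).x (u (n + 1)))

theorem logMartingale_congr {t : ℕ} {u u' : ℕ → Z} (h : ∀ n ∈ Finset.Icc 1 t, u n = u' n) :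
    logMartingale f g B C η ε c x₁ t u = logMartingale f g B C η ε c x₁ t u' := by
  refine Finset.sum_congr rfl fun n hn => ?_
  have hn := Finset.mem_range.1 hn
  rw [state_congr fun k hk => h k (Finset.Icc_subset_Icc_right hn.le hk),
    h (n + 1) (Finset.mem_Icc.2 ⟨by omega, hn⟩)]

end Martingale

/-! ### Concentration of the noise along the trajectory. -/

section Concentration

variable {Ω Z : Type*} [MeasurableSpace Ω] [MeasurableSpace Z] {μ : Measure Ω}
  [IsProbabilityMeasure μ] {P : Measure Z} {T d : ℕ} {z : ℕ → Ω → Z}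
  {f : EuclideanSpace ℝ (Fin d) → ℝ} {fstar : ℝ}
  {g : EuclideanSpace ℝ (Fin d) → Z → EuclideanSpace ℝ (Fin d)}
  {B C η ε c : ℝ} {x₁ : EuclideanSpace ℝ (Fin d)}

theorem isProbabilityMeasure_law (hT : 1 ≤ T) (hz : ∀ s, Measurable (z s))
    (hP : ∀ s ∈ Finset.Icc 1 T, μ.map (z s) = P) : IsProbabilityMeasure P := by
  rw [← hP 1 (Finset.mem_Icc.2 ⟨le_rfl, hT⟩)]
  exact Measure.isProbabilityMeasure_map (hz _).aemeasurable

/-- Along the trajectory, the bound on the noise holds almost surely. -/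
theorem ae_noise_le (hz : ∀ s, Measurable (z s))
    (hP : ∀ s ∈ Finset.Icc 1 T, μ.map (z s) = P)
    (hind : iIndepFun (fun s : Finset.Icc 1 T => z s) μ)
    (hg : Measurable (Function.uncurry g)) (hgrad : Measurable (gradient f))
    (hnoise : RelaxedAffineNoise f fstar g P 0 B C) {t : ℕ} (ht : t < T) :
    ∀ᵐ ω ∂μ, ‖g (state g 0 η ε x₁ (fun n => z n ω) t).x (z (t + 1) ω)
        - gradient f (state g 0 η ε x₁ (fun n => z n ω) t).x‖ ^ 2
      ≤ B * ‖gradient f (state g 0 η ε x₁ (fun n => z n ω) t).x‖ ^ 2 + C := by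
  -- The null set of samples violating the noise bound depends on the point, and the iterate is
  -- random. Independence of the fresh sample allows integrating the indicator of `bad` first in the
  -- sample, at a fixed iterate.
  set bad : Set (EuclideanSpace ℝ (Fin d) × Z) :=
    {q | B * ‖gradient f q.1‖ ^ 2 + C < ‖g q.1 q.2 - gradient f q.1‖ ^ 2} with hbad
  have hg' : Measurable fun q : EuclideanSpace ℝ (Fin d) × Z => g q.1 q.2 := hg
  have hbadm : MeasurableSet bad :=
    measurableSet_lt (by fun_prop) (by fun_prop)
  obtain ⟨K, hK⟩ : ∃ K : (ℕ → Z) → Z → ENNReal,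
    K = fun u w => bad.indicator 1 ((state g 0 η ε x₁ u t).x, w) := ⟨_, rfl⟩
  have hx : Measurable fun u : ℕ → Z => (state g 0 η ε x₁ u t).x := (measurable_state hg t).1
  have hKm : Measurable (Function.uncurry K) := by
    rw [hK]
    exact (measurable_one.indicator hbadm).comp ((hx.comp measurable_fst).prodMk measurable_snd)
  have hzm : Measurable fun ω n => z n ω := measurable_pi_iff.2 hz
  have hint := lintegral_past_next hz hP hind ht hKm fun u u' h => by
    simp only [hK, state_congr h]
  have hzero : ∀ u, ∫⁻ w, K u w ∂P = 0 := by
    intro u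
    refine lintegral_eq_zero_of_ae_eq_zero ?_
    filter_upwards [hnoise (state g 0 η ε x₁ u t).x] with w hw
    rw [zero_mul, zero_add] at hw
    have hmem : ((state g 0 η ε x₁ u t).x, w) ∉ bad := not_lt.2 hw
    simp only [hK, Set.indicator_of_notMem hmem, Pi.zero_apply]
  simp only [hzero, lintegral_zero] at hint
  have hKω : Measurable fun ω => K (fun n => z n ω) (z (t + 1) ω) :=
    hKm.comp (hzm.prodMk (hz (t + 1)))
  rw [lintegral_eq_zero_iff hKω] at hint
  filter_upwards [hint] with ω hω
  by_contra hlt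
  have hmem : ((state g 0 η ε x₁ (fun n => z n ω) t).x, z (t + 1) ω) ∈ bad := not_le.1 hlt
  simp only [hK, Set.indicator_of_mem hmem, Pi.one_apply, Pi.zero_apply, one_ne_zero] at hω

theorem measurable_logMartingale (hg : Measurable (Function.uncurry g))
    (hgrad : Measurable (gradient f)) (t : ℕ) :
    Measurable (logMartingale f g B C η ε c x₁ t) := by
  unfold logMartingale
  refine Finset.measurable_fun_sum _ fun n _ => ?_
  obtain ⟨hx, -, hv⟩ := measurable_state (β := 0) (η := η) (ε := ε) (x₁ := x₁) hg n
  exact measurable_logFactor_comp (hgrad.comp hx) hv (hg.comp (hx.prodMk (measurable_pi_apply _)))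

theorem lintegral_exp_logMartingale_le (hz : ∀ s, Measurable (z s))
    (hP : ∀ s ∈ Finset.Icc 1 T, μ.map (z s) = P)
    (hind : iIndepFun (fun s : Finset.Icc 1 T => z s) μ)
    (hg : Measurable (Function.uncurry g)) (hgrad : Measurable (gradient f))
    (hB : 0 ≤ B) (hC : 0 ≤ C) (hε : 0 < ε) (hmean : UnbiasedOracle f g P)
    (hnoise : RelaxedAffineNoise f fstar g P 0 B C) {t : ℕ} (ht : t ≤ T) :
    ∫⁻ ω, ENNReal.ofReal (Real.exp (logMartingale f g B C η ε c x₁ t fun n => z n ω)) ∂μ ≤ 1 := by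
  induction t with
  | zero => simp [logMartingale]
  | succ t ih =>
    have hPp := isProbabilityMeasure_law (Nat.one_le_of_lt ht) hz hP
    obtain ⟨hx, -, hv⟩ := measurable_state (β := 0) (η := η) (ε := ε) (x₁ := x₁) hg t
    set K : (ℕ → Z) → Z → ENNReal := fun u w =>
      ENNReal.ofReal (Real.exp (logMartingale f g B C η ε c x₁ t u)) *
        ENNReal.ofReal (Real.exp (logFactor B C ε c (gradient f (state g 0 η ε x₁ u t).x)
          (state g 0 η ε x₁ u t).v (g (state g 0 η ε x₁ u t).x w))) with hK
    have hfac : Measurable fun q : (ℕ → Z) × Z =>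
        logFactor B C ε c (gradient f (state g 0 η ε x₁ q.1 t).x)
          (state g 0 η ε x₁ q.1 t).v (g (state g 0 η ε x₁ q.1 t).x q.2) :=
      measurable_logFactor_comp (hgrad.comp (hx.comp measurable_fst)) (hv.comp measurable_fst)
        (hg.comp ((hx.comp measurable_fst).prodMk measurable_snd))
    have hKm : Measurable (Function.uncurry K) :=
      ((measurable_logMartingale hg hgrad t).comp measurable_fst).exp.ennreal_ofReal.mul
        hfac.exp.ennreal_ofReal
    have hint := lintegral_past_next hz hP hind ht hKm fun u u' h => by
      simp only [hK, state_congr h, logMartingale_congr h]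
    have hsucc : ∀ ω, ENNReal.ofReal (Real.exp
        (logMartingale f g B C η ε c x₁ (t + 1) fun n => z n ω)) =
        K (fun n => z n ω) (z (t + 1) ω) := by
      intro ω
      simp only [hK, logMartingale]
      rw [Finset.sum_range_succ, Real.exp_add, ENNReal.ofReal_mul (Real.exp_nonneg _)]
    simp_rw [hsucc]
    rw [hint]
    refine le_trans (lintegral_mono fun ω => ?_) (ih (by omega))
    have hfm : ∀ u : ℕ → Z, Measurable fun w => ENNReal.ofReal (Real.exp
        (logFactor B C ε c (gradient f (state g 0 η ε x₁ u t).x)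
          (state g 0 η ε x₁ u t).v (g (state g 0 η ε x₁ u t).x w))) := fun u =>
      (hfac.comp measurable_prodMk_left).exp.ennreal_ofReal
    simp only [hK]
    rw [lintegral_const_mul _ (hfm _)]
    refine mul_le_of_le_one_right' ?_
    obtain ⟨hi, hm⟩ := hmean (state g 0 η ε x₁ (fun n => z n ω) t).x
    refine lintegral_exp_logFactor_le hB hC hε (state_v_nonneg _ _) hi hm ?_ c
    simpa using hnoise (state g 0 η ε x₁ (fun n => z n ω) t).x

/-- The exponential supermartingale exceeds `T / δ` before time `T` with probability at most `δ`. -/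
theorem measure_exists_lt_logMartingale_le (hT : 1 ≤ T) {δ : ℝ} (hδ : 0 < δ)
    (hz : ∀ s, Measurable (z s)) (hP : ∀ s ∈ Finset.Icc 1 T, μ.map (z s) = P)
    (hind : iIndepFun (fun s : Finset.Icc 1 T => z s) μ)
    (hg : Measurable (Function.uncurry g)) (hgrad : Measurable (gradient f))
    (hB : 0 ≤ B) (hC : 0 ≤ C) (hε : 0 < ε) (hmean : UnbiasedOracle f g P)
    (hnoise : RelaxedAffineNoise f fstar g P 0 B C) :
    μ (⋃ t ∈ Finset.Icc 1 T, {ω | Real.log (T / δ) <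
      logMartingale f g B C η ε c x₁ t fun n => z n ω}) ≤ ENNReal.ofReal δ := by
  have hT0 : (0 : ℝ) < T := by exact_mod_cast hT
  have hzm : Measurable fun ω n => z n ω := measurable_pi_iff.2 hz
  -- Markov's inequality at level `T / δ` for each time; the union bound over `T` times explains the
  -- `T` in `log (T / δ)`.
  have htail : ∀ t ∈ Finset.Icc 1 T, μ {ω | Real.log (T / δ) <
      logMartingale f g B C η ε c x₁ t fun n => z n ω} ≤ ENNReal.ofReal (δ / T) := by
    intro t ht
    have hm : Measurable fun ω => ENNReal.ofReal (Real.exp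
        (logMartingale f g B C η ε c x₁ t fun n => z n ω)) :=
      ((measurable_logMartingale hg hgrad t).comp hzm).exp.ennreal_ofReal
    have hpos : 0 < (T : ℝ) / δ := by positivity
    have hmarkov := meas_ge_le_lintegral_div (μ := μ) hm.aemeasurable
      (ε := ENNReal.ofReal (T / δ)) (by simpa using hpos) ENNReal.ofReal_ne_top
    calc _ ≤ μ {ω | ENNReal.ofReal (T / δ) ≤ ENNReal.ofReal (Real.exp
          (logMartingale f g B C η ε c x₁ t fun n => z n ω))} := by
          refine measure_mono fun ω hω => ?_
          refine ENNReal.ofReal_le_ofReal ?_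
          exact ((Real.log_lt_iff_lt_exp hpos).1 hω).le
      _ ≤ _ := hmarkov
      _ ≤ 1 / ENNReal.ofReal (T / δ) := by
          gcongr
          exact lintegral_exp_logMartingale_le hz hP hind hg hgrad hB hC hε hmean hnoise
            (Finset.mem_Icc.1 ht).2
      _ = ENNReal.ofReal (δ / T) := by
          rw [one_div, ← ENNReal.ofReal_inv_of_pos hpos, inv_div]
  calc _ ≤ ∑ t ∈ Finset.Icc 1 T, ENNReal.ofReal (δ / T) :=
        (measure_biUnion_finset_le _ _).trans (Finset.sum_le_sum htail)
    _ = ENNReal.ofReal δ := by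
        rw [Finset.sum_const, Nat.card_Icc, Nat.add_sub_cancel, nsmul_eq_mul,
          ← ENNReal.ofReal_natCast, ← ENNReal.ofReal_mul hT0.le, mul_div_cancel₀ _ hT0.ne']

end Concentration

/-! ### Assembly of the convergence bound. -/

section Convergence

variable {d T : ℕ} {Z : Type*} {f : EuclideanSpace ℝ (Fin d) → ℝ} {fstar : ℝ}
  {g : EuclideanSpace ℝ (Fin d) → Z → EuclideanSpace ℝ (Fin d)}
  {L₀ L₁ B C C₀ η ε δ Λy Λx H L : ℝ} {x₁ : EuclideanSpace ℝ (Fin d)}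

/-- The convergence bound on the samples along which the noise is controlled. -/
theorem mean_sq_gradient_le (hd : 1 ≤ d) (hT : 1 ≤ T) (hδ : 0 < δ) (hδ1 : δ < 1) (hL₀ : 0 < L₀)
    (hL₁ : 0 < L₁) (hB : 0 ≤ B) (hC : 0 ≤ C) (hC₀ : 0 < C₀) (hη : 0 < η) (hε : 0 < ε)
    (hf : GeneralizedSmooth f L₀ L₁) (hb : BoundedBelowBy f fstar)
    (hΛy : Λy = LambdaY d T B C C₀ ε δ (f x₁ - fstar) ‖gradient f x₁‖)
    (hΛx : Λx = LambdaX d T L₀ L₁ B C C₀ ε δ (f x₁ - fstar) ‖gradient f x₁‖)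
    (hH : H = calH L₀ L₁ 0 B C Λx) (hL : L = calL L₀ L₁ Λx)
    (hηle : η ≤ min C₀ (min (C₀ / H) (min (C₀ / L) (1 / (L₁ * Real.sqrt d)))))
    {u : ℕ → Z}
    (hnoise : ∀ t < T, ‖g (state g 0 η ε x₁ u t).x (u (t + 1))
        - gradient f (state g 0 η ε x₁ u t).x‖ ^ 2
      ≤ B * ‖gradient f (state g 0 η ε x₁ u t).x‖ ^ 2 + C)
    (hmart : ∀ t ∈ Finset.Icc 1 T,
      logMartingale f g B C η ε (η / (3 * C₀)) x₁ t u ≤ Real.log (T / δ)) :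
    (1 / T : ℝ) * ∑ s ∈ Finset.Icc 1 T, ‖gradient f (iterate g 0 η ε x₁ u s)‖ ^ 2 ≤
      4 * Λy / η * ((2 * Λy * (B + 1) / η + H + ε) / T + Real.sqrt (2 * C / T)) := by
  have hT0 : (0 : ℝ) < T := by exact_mod_cast hT
  have hd0 : (0 : ℝ) < d := by exact_mod_cast hd
  have hlog0 : 0 ≤ Real.log (T / δ) := Real.log_nonneg (one_lt_div hT hδ hδ1).le
  have hΔ : 0 ≤ f x₁ - fstar := sub_nonneg.2 (hb x₁)
  have hY := LambdaY_pos (d := d) (ε := ε) (G := ‖gradient f x₁‖) hT hB hC hC₀ hδ hδ1 hΔ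
  have hX := LambdaX_lower (d := d) (ε := ε) (G := ‖gradient f x₁‖) (L₁ := L₁)
    hL₀ hT hB hC hC₀ hδ hδ1 hΔ
  rw [← hΛy] at hY hX
  rw [← hΛx] at hX
  have hΛ : Λy ≤ Λx := by
    have : 0 ≤ 8 * L₁ * Λy ^ 2 := by positivity
    linarith
  have hΛx0 : 0 < Λx := hY.trans_le hΛ
  obtain ⟨hηC₀, hηle⟩ := le_min_iff.1 hηle
  obtain ⟨hηH, hηle⟩ := le_min_iff.1 hηle
  obtain ⟨hηL, hηd⟩ := le_min_iff.1 hηle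
  have hHpos : 0 < calH L₀ L₁ 0 B C Λx := by
    unfold calH
    positivity
  have hLpos : 0 < calL L₀ L₁ Λx := by
    unfold calL
    positivity
  rw [hH, le_div_iff₀ hHpos] at hηH
  rw [hL, le_div_iff₀ hLpos] at hηL
  have hηd' : η * Real.sqrt d ≤ 1 / L₁ := by
    rw [le_div_iff₀ (by positivity)] at hηd ⊢
    linarith
  have htraj := isTrajectory_state (η := η) (ε := ε) (x₁ := x₁) u hnoise
  have hE : ∀ t ≤ T, _ := fun t ht => htraj.energy_le (Λx := Λx) (δ := δ) hf hb hL₀ hL₁ hB hC hC₀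
    hη hε hΛy hΛ hηC₀ hηH hηL hηd' (fun t ht => by
      -- The controlled event covers times `1` to `T` only; at time 0 the sums are empty and `log (T
      -- / δ) ≥ 0` suffices.
      rcases Nat.eq_zero_or_pos t with rfl | htpos
      · simp only [Finset.range_zero, Finset.sum_empty, mul_zero, neg_zero, zero_add]
        positivity
      have h1 := hmart t (Finset.mem_Icc.2 ⟨htpos, ht⟩)
      simp only [logMartingale, logFactor] at h1
      rw [Finset.sum_sub_distrib, Finset.sum_neg_distrib, ← Finset.mul_sum, ← Finset.mul_sum] at h1
      -- With the parameter `c = η / (3 C₀)`, multiplication by `3 C₀` turns `c` into `η` and `c²/2`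
      -- into `η² / (6 C₀)`.
      have h2 := mul_le_mul_of_nonneg_left h1 (show 0 ≤ 3 * C₀ by positivity)
      have e1 : ∀ a b : ℝ, 3 * C₀ * (-(η / (3 * C₀) * a) - (η / (3 * C₀)) ^ 2 / 2 * b) =
          -(η * a) - η ^ 2 / (6 * C₀) * b := by
        intro a b
        field_simp
        ring
      rw [e1] at h2
      linarith) ht
  have hW : ∀ t, 0 ≤ η / 2 * ∑ n ∈ Finset.range t, weightedSq B C ε
      (gradient f (state g 0 η ε x₁ u n).x) (state g 0 η ε x₁ u n).v := fun t =>
    mul_nonneg (by positivity) (Finset.sum_nonneg fun k _ => weightedSq_nonneg hε)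
  have hfin := htraj.sum_sq_le hT hB hC hη hε (Λ := Λy) (H := H) (fun n hn => by
      have h1 := hE n hn.le
      have h2 := hf.norm_gradient_le hL₀ hL₁ hb (state g 0 η ε x₁ u n).x (Δ := Λx) (by
        linarith [hW n])
      refine (noiseBound_mono hB (norm_nonneg _) h2).trans (le_of_eq ?_)
      simp [hH, calH, noiseBound])
    (by linarith [hE T le_rfl, hb (state g 0 η ε x₁ u T).x])
  have hsum : ∑ s ∈ Finset.Icc 1 T, ‖gradient f (iterate g 0 η ε x₁ u s)‖ ^ 2 =
      ∑ n ∈ Finset.range T, ‖gradient f (state g 0 η ε x₁ u n).x‖ ^ 2 := by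
    rw [Finset.range_eq_Ico, ← Finset.Ico_add_one_right_eq_Icc]
    exact (Finset.sum_Ico_add' (fun s => ‖gradient f (iterate g 0 η ε x₁ u s)‖ ^ 2) 0 T 1).symm
  have hsqrt : Real.sqrt (2 * C * T) = Real.sqrt (2 * C / T) * T := by
    rw [show 2 * C * (T : ℝ) = 2 * C / T * T ^ 2 by field_simp,
      Real.sqrt_mul (by positivity), Real.sqrt_sq hT0.le]
  rw [hsum, one_div, inv_mul_le_iff₀ hT0]
  refine hfin.trans (le_of_eq ?_)
  rw [hsqrt]
  field_simp

end Convergence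

/-- Convergence of AdaGrad with high probability. -/
theorem high_probability_convergence {Ω : Type*} [MeasurableSpace Ω] (μ : Measure Ω)
    [IsProbabilityMeasure μ] {Z : Type*} [MeasurableSpace Z] (P : Measure Z)
    {d T : ℕ} {f : EuclideanSpace ℝ (Fin d) → ℝ} {fstar : ℝ}
    {g : EuclideanSpace ℝ (Fin d) → Z → EuclideanSpace ℝ (Fin d)}
    {z : ℕ → Ω → Z} {x₁ : EuclideanSpace ℝ (Fin d)} {L₀ L₁ B C C₀ η ε δ Λy Λx H L : ℝ}
    (hd : 1 ≤ d) (hT : 1 ≤ T) (hδ : 0 < δ) (hδ1 : δ < 1) (hL₀ : 0 < L₀) (hL₁ : 0 < L₁)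
    (hB : 0 ≤ B) (hC : 0 ≤ C) (hC₀ : 0 < C₀) (hη : 0 < η) (hε : 0 < ε)
    (hz : ∀ s ∈ Finset.Icc 1 T, Measurable (z s) ∧ μ.map (z s) = P)
    (hind : iIndepFun (fun s : Finset.Icc 1 T => z s) μ)
    (hg : Measurable (Function.uncurry g)) (hf : GeneralizedSmooth f L₀ L₁)
    (hb : BoundedBelowBy f fstar) (hmean : UnbiasedOracle f g P)
    (hnoise : RelaxedAffineNoise f fstar g P 0 B C)
    (hΛy : Λy = LambdaY d T B C C₀ ε δ (f x₁ - fstar) ‖gradient f x₁‖)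
    (hΛx : Λx = LambdaX d T L₀ L₁ B C C₀ ε δ (f x₁ - fstar) ‖gradient f x₁‖)
    (hH : H = calH L₀ L₁ 0 B C Λx) (hL : L = calL L₀ L₁ Λx)
    (hηle : η ≤ min C₀ (min (C₀ / H) (min (C₀ / L) (1 / (L₁ * Real.sqrt d))))) :
    ENNReal.ofReal (1 - δ) ≤
      μ {ω | (1 / T : ℝ) * ∑ s ∈ Finset.Icc 1 T,
            ‖gradient f (iterate g 0 η ε x₁ (fun n => z n ω) s)‖ ^ 2 ≤
          4 * Λy / η * ((2 * Λy * (B + 1) / η + H + ε) / T + Real.sqrt (2 * C / T))} := by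
  have hgrad : Measurable (gradient f) := (hf.continuous_gradient hL₁).measurable
  -- Samples outside `1, …, T` need not be measurable; overwriting them by `z 1` does not affect
  -- `x_1, …, x_T`.
  obtain ⟨z', hz'⟩ : ∃ z' : ℕ → Ω → Z,
    z' = fun s => if s ∈ Finset.Icc 1 T then z s else z 1 := ⟨_, rfl⟩
  have hzz' : ∀ s ∈ Finset.Icc 1 T, z' s = z s := fun s hs => by rw [hz']; exact if_pos hs
  have hm' : ∀ s, Measurable (z' s) := by
    intro s
    by_cases hs : s ∈ Finset.Icc 1 T
    · rw [hzz' s hs]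
      exact (hz s hs).1
    · simp only [hz', if_neg hs]
      exact (hz 1 (Finset.mem_Icc.2 ⟨le_rfl, hT⟩)).1
  have hP' : ∀ s ∈ Finset.Icc 1 T, μ.map (z' s) = P := fun s hs => by
    rw [hzz' s hs]
    exact (hz s hs).2
  have hind' : iIndepFun (fun s : Finset.Icc 1 T => z' s) μ := by
    have : (fun s : Finset.Icc 1 T => z' s) = fun s : Finset.Icc 1 T => z s :=
      funext fun s => hzz' s s.2
    rwa [this]
  set good := {ω | (1 / T : ℝ) * ∑ s ∈ Finset.Icc 1 T,
            ‖gradient f (iterate g 0 η ε x₁ (fun n => z n ω) s)‖ ^ 2 ≤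
          4 * Λy / η * ((2 * Λy * (B + 1) / η + H + ε) / T + Real.sqrt (2 * C / T))}
  set bad := ⋃ t ∈ Finset.Icc 1 T, {ω | Real.log (T / δ) <
      logMartingale f g B C η ε (η / (3 * C₀)) x₁ t fun n => z' n ω} with hbad
  have hbadle : μ bad ≤ ENNReal.ofReal δ :=
    measure_exists_lt_logMartingale_le hT hδ hm' hP' hind' hg hgrad hB hC hε hmean hnoise
  have hae : ∀ᵐ ω ∂μ, ∀ t ∈ Finset.range T,
      ‖g (state g 0 η ε x₁ (fun n => z' n ω) t).x (z' (t + 1) ω)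
        - gradient f (state g 0 η ε x₁ (fun n => z' n ω) t).x‖ ^ 2
      ≤ B * ‖gradient f (state g 0 η ε x₁ (fun n => z' n ω) t).x‖ ^ 2 + C :=
    (Finset.eventually_all _).2 fun t ht =>
      ae_noise_le hm' hP' hind' hg hgrad hnoise (Finset.mem_range.1 ht)
  have hiter : ∀ ω, ∑ s ∈ Finset.Icc 1 T,
      ‖gradient f (iterate g 0 η ε x₁ (fun n => z n ω) s)‖ ^ 2 =
      ∑ s ∈ Finset.Icc 1 T, ‖gradient f (iterate g 0 η ε x₁ (fun n => z' n ω) s)‖ ^ 2 := by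
    intro ω
    refine Finset.sum_congr rfl fun s hs => ?_
    have : state g 0 η ε x₁ (fun n => z n ω) (s - 1) =
        state g 0 η ε x₁ (fun n => z' n ω) (s - 1) := by
      refine state_congr fun n hn => ?_
      rw [Finset.mem_Icc] at hs hn
      rw [hzz' n (Finset.mem_Icc.2 ⟨hn.1, by omega⟩)]
    rw [iterate, iterate, this]
  have hcover : ∀ᵐ ω ∂μ, ω ∈ goodᶜ → ω ∈ bad := by
    filter_upwards [hae] with ω hω hgoodω
    by_contra hnot
    refine hgoodω ?_
    have hnot' : ∀ t ∈ Finset.Icc 1 T,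
        logMartingale f g B C η ε (η / (3 * C₀)) x₁ t (fun n => z' n ω) ≤ Real.log (T / δ) := by
      intro t ht
      by_contra! hlt
      exact hnot (Set.mem_biUnion ht hlt)
    have hres := mean_sq_gradient_le hd hT hδ hδ1 hL₀ hL₁ hB hC hC₀ hη hε hf hb hΛy hΛx hH hL hηle
      (u := fun n => z' n ω) (fun t ht => hω t (Finset.mem_range.2 ht)) hnot'
    rw [← hiter ω] at hres
    exact hres
  -- Only subadditivity is used, so `good` need not be measurable.
  have hone : 1 ≤ μ good + ENNReal.ofReal δ := by
    calc 1 = μ (good ∪ goodᶜ) := by rw [Set.union_compl_self, measure_univ]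
      _ ≤ μ good + μ goodᶜ := measure_union_le _ _
      _ ≤ μ good + ENNReal.ofReal δ := by
        gcongr
        exact (measure_mono_ae hcover).trans hbadle
  rw [ENNReal.ofReal_sub _ hδ.le, ENNReal.ofReal_one]
  exact tsub_le_iff_right.2 hone

end AdaGrad

end

theorem mainTheorem4 :
    -- order of `Λ_y`, with a universal constant
    (∃ c : ℝ, 0 < c ∧
      ∀ (d T : ℕ) (B C C₀ ε δ Δ₁ G : ℝ), 1 ≤ d → 1 ≤ T → 0 ≤ B → 0 ≤ C → 0 < C₀ → 0 < ε →
        0 < δ → δ < 1 → 0 ≤ Δ₁ → 0 ≤ G →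
        AdaGrad.LambdaY d T B C C₀ ε δ Δ₁ G ≤
          c * (Δ₁ + (C₀ ^ 2 * d + C₀ * d) *
            (Real.log (T / δ + T / ε ^ 2)
              + Real.log (1 + (B + 1) * (G ^ 2 + C₀ ^ 2 * d) + C)))) ∧
    -- order of `Λ_y` in `T, δ, ε, Δ₁`, with constants depending on the other parameters
    (∀ (d : ℕ) (B C C₀ G : ℝ), 1 ≤ d → 0 ≤ B → 0 ≤ C → 0 < C₀ → 0 ≤ G →
      ∃ k K : ℝ, 0 < k ∧ 0 < K ∧
        ∀ (T : ℕ) (ε δ Δ₁ : ℝ), 1 ≤ T → 0 < ε → 0 < δ → δ < 1 → 0 ≤ Δ₁ →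
          k * (Δ₁ + C₀ ^ 2 * d * Real.log (T / δ + T / ε ^ 2)) ≤
              AdaGrad.LambdaY d T B C C₀ ε δ Δ₁ G ∧
          AdaGrad.LambdaY d T B C C₀ ε δ Δ₁ G ≤
              K * (Δ₁ + C₀ ^ 2 * d * Real.log (T / δ + T / ε ^ 2))) ∧
    -- order of `Λ_x`
    (∀ L₀ L₁ C₀ : ℝ, 0 < L₀ → 0 < L₁ → 0 < C₀ →
      ∃ k K : ℝ, 0 < k ∧ 0 < K ∧
        ∀ (d T : ℕ) (B C ε δ Δ₁ G : ℝ), 1 ≤ d → 1 ≤ T → 0 ≤ B → 0 ≤ C → 0 < ε →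
          0 < δ → δ < 1 → 0 ≤ Δ₁ → 0 ≤ G →
          k * AdaGrad.LambdaY d T B C C₀ ε δ Δ₁ G ^ 2 ≤
              AdaGrad.LambdaX d T L₀ L₁ B C C₀ ε δ Δ₁ G ∧
          AdaGrad.LambdaX d T L₀ L₁ B C C₀ ε δ Δ₁ G ≤
              K * (AdaGrad.LambdaY d T B C C₀ ε δ Δ₁ G
                + AdaGrad.LambdaY d T B C C₀ ε δ Δ₁ G ^ 2) ∧
          (2 ≤ T → AdaGrad.LambdaX d T L₀ L₁ B C C₀ ε δ Δ₁ G ≤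
              K * AdaGrad.LambdaY d T B C C₀ ε δ Δ₁ G ^ 2)) ∧
    -- the convergence bound
    (∀ (Ω : Type*) [MeasurableSpace Ω] (μ : Measure Ω) [IsProbabilityMeasure μ]
      (Z : Type*) [MeasurableSpace Z] (P : Measure Z)
      (d T : ℕ) (f : EuclideanSpace ℝ (Fin d) → ℝ) (fstar : ℝ)
      (g : EuclideanSpace ℝ (Fin d) → Z → EuclideanSpace ℝ (Fin d))
      (z : ℕ → Ω → Z) (x₁ : EuclideanSpace ℝ (Fin d))
      (L₀ L₁ B C C₀ η ε δ Λy Λx H L : ℝ),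
      1 ≤ d → 1 ≤ T → 0 < δ → δ < 1 →
      0 < L₀ → 0 < L₁ → 0 ≤ B → 0 ≤ C → 0 < C₀ → 0 < η → 0 < ε →
      -- the samples `z₁, …, z_T` are independent with law `P`
      (∀ s ∈ Finset.Icc 1 T, Measurable (z s) ∧ μ.map (z s) = P) →
      iIndepFun (fun s : Finset.Icc 1 T => z s) μ →
      Measurable (Function.uncurry g) →
      AdaGrad.GeneralizedSmooth f L₀ L₁ →
      AdaGrad.BoundedBelowBy f fstar →
      AdaGrad.UnbiasedOracle f g P →
      AdaGrad.RelaxedAffineNoise f fstar g P 0 B C →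
      Λy = AdaGrad.LambdaY d T B C C₀ ε δ (f x₁ - fstar) ‖gradient f x₁‖ →
      Λx = AdaGrad.LambdaX d T L₀ L₁ B C C₀ ε δ (f x₁ - fstar) ‖gradient f x₁‖ →
      H = AdaGrad.calH L₀ L₁ 0 B C Λx →
      L = AdaGrad.calL L₀ L₁ Λx →
      η ≤ min C₀ (min (C₀ / H) (min (C₀ / L) (1 / (L₁ * Real.sqrt d)))) →
      ENNReal.ofReal (1 - δ) ≤
        μ {ω | (1 / T : ℝ) * ∑ s ∈ Finset.Icc 1 T,
              ‖gradient f (AdaGrad.iterate g 0 η ε x₁ (fun n => z n ω) s)‖ ^ 2 ≤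
            4 * Λy / η *
              ((2 * Λy * (B + 1) / η + H + ε) / T + Real.sqrt (2 * C / T))}) := by
  refine ⟨⟨8, by norm_num, fun d T B C C₀ ε δ Δ₁ G hd hT hB hC hC₀ hε hδ hδ1 hΔ _ =>
      AdaGrad.LambdaY_le_universal hd hT hB hC hC₀ hε hδ hδ1 hΔ⟩,
    fun d B C C₀ G hd hB hC hC₀ hG => AdaGrad.exists_LambdaY_bounds hd hB hC hC₀ hG,
    fun L₀ L₁ C₀ hL₀ hL₁ hC₀ => AdaGrad.exists_LambdaX_bounds hL₀ hL₁ hC₀, ?_⟩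
  intro Ω _ μ _ Z _ P d T f fstar g z x₁ L₀ L₁ B C C₀ η ε δ Λy Λx H L hd hT hδ hδ1 hL₀ hL₁ hB hC
    hC₀ hη hε hz hind hg hf hb hmean hnoise hΛy hΛx hH hL hηle
  exact AdaGrad.high_probability_convergence μ P hd hT hδ hδ1 hL₀ hL₁ hB hC hC₀ hη hε hz hind hg
    hf hb hmean hnoise hΛy hΛx hH hL hηle
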